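/- **Theorem 1.1 (Double shuffle relations for $\widehat{\mathcal S}$-MZVs).** *Notation.* An index is a finite (possibly empty) tuple $\boldsymbol k=(k_1,\dots,k_r)$ of positive integers; $\mathrm{wt}(\boldsymbol k)=k_1+\cdots+k_r$, $\mathrm{dep}(\boldsymbol k)=r$, $\overline{\boldsymbol k}=(k_r,\dots,k_1)$, $\boldsymbol k_{[i]}=(k_1,\dots,k_i)$, $\boldsymbol k^{[i]}=(k_{i+1},\dots,k_r)$, and for $\boldsymbol l\in\mathbb Z_{\ge0}^r$ we put $\mathrm{wt}(\boldsymbol l)=l_1+\cdots+l_r$ and $b\binom{\boldsymbol k}{\boldsymbol l}=\prod_{j=1}^r\binom{k_j+l_j-1}{l_j}$. The index $\boldsymbol k$ is admissible if it is empty or $k_r\ge2$; then $\zeta(\boldsymbol k)=\sum_{0<n_1<\cdots<n_r}n_1^{-k_1}\cdots n_r^{-k_r}$, with $\zeta(\varnothing)=1$. Let $\mathcal Z\subset\mathbb R$ be the $\mathbb Q$-subalgebra generated by these values. In $\mathbb Q\langle x,y\rangle$ put $z_k=yx^{k-1}$ and $z_{\boldsymbol k}=z_{k_1}\cdots z_{k_r}$.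 Let $\mathfrak H^1$ and $\mathfrak H^0$ be the $\mathbb Q$-spans of the $z_{\boldsymbol k}$ with $\boldsymbol k$ an arbitrary, respectively an admissible, index. The harmonic product $*$ on $\mathfrak H^1$ and the shuffle product ш on $\mathbb Q\langle x,y\rangle$ (under which $\mathfrak H^1$ is closed) are the bilinear products with unit $1$ such that $$w_1z_a*w_2z_b=(w_1*w_2z_b)z_a+(w_1z_a*w_2)z_b+(w_1*w_2)z_{a+b},$$ $$w_1u_1\text{ ш }w_2u_2=(w_1\text{ ш }w_2u_2)u_1+(w_1u_1\text{ ш }w_2)u_2\qquad(u_1,u_2\in\{x,y\}).$$ For $\bullet\in\{*,\text{ш}\}$ every element of $\mathfrak H^1$ is uniquely a polynomial in $y$ with coefficients in $\mathfrak H^0$ with respect to $\bullet$. Let $Z^\bullet\colon(\mathfrak H^1,\bullet)\to\mathcal Z[T]$ be the unique $\mathbb Q$-algebra homomorphism with $Z^\bullet(z_{\boldsymbol k})=\zeta(\boldsymbol k)$ for admissible $\boldsymbol k$ and $Z^\bullet(y)=T$, and let $\zeta^\bullet(\boldsymbol k)\in\mathcal Z$ be the value of $Z^\bullet(z_{\boldsymbol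 k})$ at $T=0$. For an index $\boldsymbol k$ of depth $r$ define $$\zeta^\bullet_{\widehat{\mathcal S}}(\boldsymbol k)=\sum_{i=0}^r(-1)^{\mathrm{wt}(\boldsymbol k^{[i]})}\zeta^\bullet(\boldsymbol k_{[i]})\sum_{\boldsymbol l\in\mathbb Z_{\ge0}^{r-i}}b\binom{\boldsymbol k^{[i]}}{\boldsymbol l}\,\zeta^\bullet\bigl(\overline{\boldsymbol k^{[i]}+\boldsymbol l}\bigr)\,t^{\mathrm{wt}(\boldsymbol l)}\in\mathcal Z[[t]].$$ Finally, $\zeta^\bullet_{\widehat{\mathcal S}}(\boldsymbol k\bullet\boldsymbol l)$ means $\sum_{\boldsymbol h}\zeta^\bullet_{\widehat{\mathcal S}}(\boldsymbol h)$ when $z_{\boldsymbol k}\bullet z_{\boldsymbol l}=\sum_{\boldsymbol h}z_{\boldsymbol h}$ (with multiplicities). *Statement.* For all indices $\boldsymbol k$ and $\boldsymbol l$ one has, in $\mathcal Z[[t]]$, $$\zeta^{*}_{\widehat{\mathcal S}}(\boldsymbol k*\boldsymbol l)=\zeta^{*}_{\widehat{\mathcal S}}(\boldsymbol k)\,\zeta^{*}_{\widehat{\mathcal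 S}}(\boldsymbol l),$$ $$\zeta^{\text{ш}}_{\widehat{\mathcal S}}(\boldsymbol k\text{ ш }\boldsymbol l)=(-1)^{\mathrm{wt}(\boldsymbol l)}\sum_{\boldsymbol l'\in\mathbb Z_{\ge0}^{\mathrm{dep}(\boldsymbol l)}}b\binom{\boldsymbol l}{\boldsymbol l'}\,\zeta^{\text{ш}}_{\widehat{\mathcal S}}\bigl(\boldsymbol k,\overline{\boldsymbol l+\boldsymbol l'}\bigr)\,t^{\mathrm{wt}(\boldsymbol l')},$$ where $(\boldsymbol k,\overline{\boldsymbol l+\boldsymbol l'})$ is the concatenation. -/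

import Mathlib

namespace TadicMZV

/-! ### Indices -/

/-- An index `(k₁, …, k_r)` is a finite sequence of positive integers; `[]` is the empty index. -/
abbrev Index : Type := List ℕ+

/-- The weight `k₁ + ⋯ + k_r`. -/
def wt (k : Index) : ℕ := (k.map (fun a => (a : ℕ))).sum

/-- An index is admissible if it is empty or its last entry is at least `2`. -/
def Admissible (k : Index) : Prop := ∀ a ∈ k.getLast?, 2 ≤ a

/-- The tuple `k + l = (k₁ + l₁, …, k_r + l_r)`, for an index `k` and a tuple `l` of
non-negative integers of the same depth. -/
def shift (k : Index) (l : Fin k.length → ℕ) : Index :=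
  List.ofFn fun j => ⟨(k.get j : ℕ) + l j, Nat.add_pos_left (k.get j).pos (l j)⟩

/-- `b(k; l) = ∏ⱼ binom(kⱼ + lⱼ - 1, lⱼ)`. -/
def bcoeff (k : Index) (l : Fin k.length → ℕ) : ℕ :=
  ∏ j, ((k.get j : ℕ) + l j - 1).choose (l j)

/-! ### The harmonic and the shuffle product

Both products of two basis elements are sums of basis elements with non-negative integer
multiplicities, and are recorded as multisets. The defining recursions split off the *last*
letters; so they are written for sequences listed from right to left, and reversed afterwards. -/

/-- The harmonic product, for indices listed from right to left:
`(w₁ z_a) * (w₂ z_b) = (w₁ * w₂ z_b) z_a + (w₁ z_a * w₂) z_b + (w₁ * w₂) z_{a+b}`. -/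
def harmonicRev : List ℕ+ → List ℕ+ → Multiset (List ℕ+)
  | [], v => {v}
  | a :: u, [] => {a :: u}
  | a :: u, b :: v =>
      (harmonicRev u (b :: v)).map (fun w => a :: w)
        + (harmonicRev (a :: u) v).map (fun w => b :: w)
        + (harmonicRev u v).map (fun w => (a + b) :: w)
  termination_by u v => u.length + v.length

/-- The multiset of the indices `h` with `z_k * z_l = ∑_h z_h`. -/
def harmonicProd (k l : Index) : Multiset Index :=
  (harmonicRev k.reverse l.reverse).map List.reverse

/-- The two letters of `ℚ⟨x, y⟩`. -/
inductive Letter : Type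
  | x : Letter
  | y : Letter

/-- The shuffle product, for words listed from right to left:
`(w₁ a) ш (w₂ b) = (w₁ ш w₂ b) a + (w₁ a ш w₂) b`. -/
def wordShuffleRev : List Letter → List Letter → Multiset (List Letter)
  | [], v => {v}
  | a :: u, [] => {a :: u}
  | a :: u, b :: v =>
      (wordShuffleRev u (b :: v)).map (fun w => a :: w)
        + (wordShuffleRev (a :: u) v).map (fun w => b :: w)
  termination_by u v => u.length + v.length

/-- The multiset of words occurring in the shuffle product of two words. -/
def wordShuffle (u v : List Letter) : Multiset (List Letter) :=
  (wordShuffleRev u.reverse v.reverse).map List.reverse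

/-- The word `z_k = y x^{k₁-1} ⋯ y x^{k_r-1}`. -/
def word (k : Index) : List Letter :=
  k.flatMap fun a => Letter.y :: List.replicate ((a : ℕ) - 1) Letter.x

/-- Reads a word from right to left; `c - 1` is the number of letters `x` met since the last `y`. -/
def decodeRev : ℕ+ → List Letter → List ℕ+
  | _, [] => []
  | c, Letter.x :: w => decodeRev (c + 1) w
  | c, Letter.y :: w => c :: decodeRev 1 w

/-- The index `k` with `word k = w`, for an empty word or a word `w` that begins with `y`. -/
def decode (w : List Letter) : Index := (decodeRev 1 w.reverse).reverse

/-- The multiset of the indices `h` with `z_k ш z_l = ∑_h z_h` (see `map_word_shuffle`). -/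
def shuffleProd (k l : Index) : Multiset Index := (wordShuffle (word k) (word l)).map decode

/-- The words listed from right to left that are empty or begin (on the left) with `y`. -/
def GoodRev (v : List Letter) : Prop := ∀ a ∈ v.getLast?, a = Letter.y

theorem goodRev_tail {a : Letter} {v : List Letter} (h : GoodRev (a :: v)) : GoodRev v := by
  cases v with
  | nil => simp [GoodRev]
  | cons b w => simpa [GoodRev] using h

theorem goodRev_cons {a : Letter} {v : List Letter} (h : GoodRev v)
    (h' : v = [] → a = Letter.y) : GoodRev (a :: v) := by
  cases v with
  | nil => simpa [GoodRev] using h'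
  | cons b w => simpa [GoodRev] using h

theorem wordShuffleRev_ne_nil (u v : List Letter) (h : u ≠ [] ∨ v ≠ []) :
    ∀ w ∈ wordShuffleRev u v, w ≠ [] := by
  intro w hw
  cases u with
  | nil => simp [wordShuffleRev] at hw; subst hw; simpa using h
  | cons a u =>
    cases v with
    | nil => simp [wordShuffleRev] at hw; simp [hw]
    | cons b v =>
      simp only [wordShuffleRev, Multiset.mem_add, Multiset.mem_map] at hw
      rcases hw with ⟨w', _, rfl⟩ | ⟨w', _, rfl⟩ <;> simp

theorem goodRev_wordShuffleRev (u v : List Letter) (hu : GoodRev u) (hv : GoodRev v) :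
    ∀ w ∈ wordShuffleRev u v, GoodRev w := by
  induction u, v using wordShuffleRev.induct with
  | case1 v => simpa [wordShuffleRev] using hv
  | case2 a u => simpa [wordShuffleRev] using hu
  | case3 a u b v ih1 ih2 =>
    intro w hw
    simp only [wordShuffleRev, Multiset.mem_add, Multiset.mem_map] at hw
    rcases hw with ⟨w', hw', rfl⟩ | ⟨w', hw', rfl⟩
    · refine goodRev_cons (ih1 (goodRev_tail hu) hv w' hw') fun h => ?_
      exact absurd h (wordShuffleRev_ne_nil _ _ (Or.inr (by simp)) w' hw')
    · refine goodRev_cons (ih2 hu (goodRev_tail hv) w' hw') fun h => ?_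
      exact absurd h (wordShuffleRev_ne_nil _ _ (Or.inl (by simp)) w' hw')

/-- The word of an index, both listed from right to left. -/
theorem word_reverse_cons (a : ℕ+) (u : List ℕ+) :
    (word (a :: u).reverse).reverse
      = List.replicate ((a : ℕ) - 1) Letter.x ++ Letter.y :: (word u.reverse).reverse := by
  simp [word]

theorem word_decodeRev (v : List Letter) (hv : GoodRev v) (c : ℕ+) (h : v = [] → c = 1) :
    (word (decodeRev c v).reverse).reverse = List.replicate ((c : ℕ) - 1) Letter.x ++ v := by
  induction v generalizing c with
  | nil => simp [h rfl, decodeRev, word]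
  | cons a v ih =>
    cases a with
    | x =>
      have hne : v ≠ [] := by rintro rfl; simp [GoodRev] at hv
      rw [decodeRev, ih (goodRev_tail hv) _ (fun h => absurd h hne)]
      have : ((c + 1 : ℕ+) : ℕ) - 1 = ((c : ℕ) - 1) + 1 := by
        have := c.pos; simp only [PNat.add_coe, PNat.one_coe]; omega
      rw [this, List.replicate_succ']
      simp
    | y =>
      rw [decodeRev, word_reverse_cons, ih (goodRev_tail hv) 1 (fun _ => rfl)]
      simp

theorem goodRev_word_reverse (u : List ℕ+) : GoodRev (word u.reverse).reverse := by
  induction u with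
  | nil => simp [word, GoodRev]
  | cons a u ih =>
    rw [word_reverse_cons]
    have h : GoodRev (Letter.y :: (word u.reverse).reverse) := goodRev_cons ih fun _ => rfl
    intro b hb
    rw [List.getLast?_append_of_ne_nil _ (by simp)] at hb
    exact h b hb

/-- `z_k ш z_l = ∑_h z_h`, with `h` running through `shuffleProd k l`. -/
theorem map_word_shuffle (k l : Index) :
    (shuffleProd k l).map word = wordShuffle (word k) (word l) := by
  rw [shuffleProd, Multiset.map_map]
  conv_rhs => rw [← Multiset.map_id (wordShuffle (word k) (word l))]
  refine Multiset.map_congr rfl fun w hw => ?_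
  rw [wordShuffle, Multiset.mem_map] at hw
  obtain ⟨v, hv, rfl⟩ := hw
  have hg : GoodRev v := goodRev_wordShuffleRev _ _
    (by simpa using goodRev_word_reverse k.reverse)
    (by simpa using goodRev_word_reverse l.reverse) v hv
  have := word_decodeRev v hg 1 (fun _ => rfl)
  simp only [PNat.one_coe, Nat.sub_self, List.replicate_zero, List.nil_append] at this
  have h2 : word (decodeRev 1 v).reverse = v.reverse := by
    conv_rhs => rw [← this]
    rw [List.reverse_reverse]
  rw [Function.comp_apply, decode, List.reverse_reverse, h2, id]

/-! ### The spaces `ℌ⁰ ⊆ ℌ¹` and the presentation of `ℌ¹` as polynomials in `y` over `ℌ⁰` -/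

/-- The `ℚ`-vector space `ℌ¹ = ℚ + yℚ⟨x, y⟩`, through its basis `z_k` (`k` an index). -/
abbrev H1 : Type := Index →₀ ℚ

/-- The subspace `ℌ⁰ = ℚ + yℚ⟨x, y⟩x` of `ℌ¹`, through its basis `z_k` (`k` admissible). -/
abbrev H0 : Type := {k : Index // Admissible k} →₀ ℚ

/-- The inclusion of `ℌ⁰` into `ℌ¹`. -/
noncomputable def inclH0 : H0 →ₗ[ℚ] H1 := Finsupp.lmapDomain ℚ ℚ Subtype.val

/-- The basis element `z_k` of `ℌ¹`. -/
noncomputable def z (k : Index) : H1 := Finsupp.single k 1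

/-- The bilinear product on `ℌ¹` with `z_k • z_l = ∑_{h ∈ P k l} z_h`. -/
noncomputable def mulH1 (P : Index → Index → Multiset Index) : H1 →ₗ[ℚ] H1 →ₗ[ℚ] H1 :=
  Finsupp.linearCombination ℚ fun k =>
    Finsupp.linearCombination ℚ fun l => ((P k l).map z).sum

/-- Multiplication `w ↦ w • y` by `y = z_1`. -/
noncomputable def mulY (P : Index → Index → Multiset Index) : H1 →ₗ[ℚ] H1 :=
  (mulH1 P).flip (z [1])

/-- The map `ℌ⁰[y] → ℌ¹`, `∑ᵢ wᵢ yⁱ ↦ ∑ᵢ wᵢ • y • ⋯ • y` (`i` factors `y`). A polynomial with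
coefficients in `ℌ⁰` is given as the finitely supported sequence of its coefficients. -/
noncomputable def evalY (P : Index → Index → Multiset Index) : (ℕ →₀ H0) →ₗ[ℚ] H1 :=
  Finsupp.lsum ℚ fun i => (mulY P ^ i) ∘ₗ inclH0

/-- The number of trailing `1`s of an index listed from right to left. -/
def onesRev : List ℕ+ → ℕ
  | [] => 0
  | a :: u => if a = 1 then onesRev u + 1 else 0

/-- The number of trailing `1`s of an index. -/
def ones (k : Index) : ℕ := onesRev k.reverse

theorem admissible_iff (k : Index) : Admissible k ↔ ones k = 0 := by
  induction k using List.reverseRecOn with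
  | nil => simp [Admissible, ones, onesRev]
  | append_singleton k a =>
    simp only [Admissible, ones, onesRev, List.getLast?_append, List.getLast?_singleton,
      Option.some_or, Option.mem_def, Option.some.injEq, List.reverse_append, List.reverse_cons,
      List.reverse_nil, List.nil_append, List.cons_append, forall_eq']
    by_cases h : a = 1
    · subst h; simp
    · simp only [h, if_false, iff_true]
      have h1 : (a : ℕ) ≠ 1 := fun h' => h (PNat.coe_injective h')
      have h2 := a.pos
      show ((2 : ℕ+) : ℕ) ≤ (a : ℕ)
      simp only [PNat.val_ofNat]; omega

/-- The property of a product that makes multiplication by `y` triangular. -/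
def Triangular (P : Index → Index → Multiset Index) : Prop :=
  ∀ k, ∃ R : Multiset Index, P k [1] = Multiset.replicate (ones k + 1) (k ++ [1]) + R ∧
    ∀ h ∈ R, ones h ≤ ones k

theorem harmonicRev_one (u : List ℕ+) : ∃ R : Multiset (List ℕ+),
    harmonicRev u [1] = Multiset.replicate (onesRev u + 1) (1 :: u) + R ∧
      ∀ h ∈ R, onesRev h ≤ onesRev u := by
  induction u with
  | nil => exact ⟨0, by simp [harmonicRev, onesRev]⟩
  | cons a u ih =>
    obtain ⟨R, hR, hR'⟩ := ih
    have hnil : harmonicRev u [] = {u} := by cases u <;> simp [harmonicRev]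
    have ha : a + 1 ≠ 1 := by
      intro h; have := congrArg PNat.val h; have := a.pos; simp at *
    by_cases h : a = 1
    · subst h
      refine ⟨R.map (fun w => 1 :: w) + {(1 + 1) :: u}, ?_, ?_⟩
      · simp only [harmonicRev, hR, hnil, onesRev, if_true, Multiset.map_add,
          Multiset.map_replicate, Multiset.map_singleton]
        rw [Multiset.replicate_succ (n := onesRev u + 1), ← Multiset.singleton_add]
        abel
      · intro w hw
        simp only [Multiset.mem_add, Multiset.mem_map, Multiset.mem_singleton] at hw
        rcases hw with ⟨w', hw', rfl⟩ | rfl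
        · simpa [onesRev] using hR' w' hw'
        · simp only [onesRev, ha, if_false]; omega
    · refine ⟨(harmonicRev u [1]).map (fun w => a :: w) + {(a + 1) :: u}, ?_, ?_⟩
      · simp only [harmonicRev, hnil, onesRev, h, if_false, Multiset.map_singleton,
          zero_add, Multiset.replicate_one]
        abel
      · intro w hw
        simp only [Multiset.mem_add, Multiset.mem_map, Multiset.mem_singleton] at hw
        rcases hw with ⟨w', hw', rfl⟩ | rfl
        · simp [onesRev, h]
        · simp [onesRev, ha]

theorem triangular_harmonic : Triangular harmonicProd := by
  intro k
  obtain ⟨R, hR, hR'⟩ := harmonicRev_one k.reverse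
  refine ⟨R.map List.reverse, ?_, ?_⟩
  · simp [harmonicProd, hR, ones]
  · intro h hh
    obtain ⟨w, hw, rfl⟩ := Multiset.mem_map.1 hh
    simpa [ones] using hR' w hw

/-- The number of trailing letters `y` of a word listed from right to left. -/
def ysRev : List Letter → ℕ
  | Letter.y :: u => ysRev u + 1
  | _ => 0

theorem wordShuffleRev_y (u : List Letter) : ∃ R : Multiset (List Letter),
    wordShuffleRev u [Letter.y] = Multiset.replicate (ysRev u + 1) (Letter.y :: u) + R ∧
      ∀ h ∈ R, ysRev h ≤ ysRev u := by
  induction u with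
  | nil => exact ⟨0, by simp [wordShuffleRev, ysRev]⟩
  | cons a u ih =>
    obtain ⟨R, hR, hR'⟩ := ih
    cases a with
    | y =>
      refine ⟨R.map (fun w => Letter.y :: w), ?_, ?_⟩
      · simp only [wordShuffleRev, hR, ysRev, Multiset.map_add,
          Multiset.map_replicate, Multiset.map_singleton]
        rw [Multiset.replicate_succ (n := ysRev u + 1), ← Multiset.singleton_add]
        abel
      · intro w hw
        obtain ⟨w', hw', rfl⟩ := Multiset.mem_map.1 hw
        simpa [ysRev] using hR' w' hw'
    | x =>
      refine ⟨(wordShuffleRev u [Letter.y]).map (fun w => Letter.x :: w), ?_, ?_⟩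
      · simp only [wordShuffleRev, ysRev, Multiset.map_singleton,
          zero_add, Multiset.replicate_one]
        abel
      · intro w hw
        obtain ⟨w', hw', rfl⟩ := Multiset.mem_map.1 hw
        simp [ysRev]

theorem onesRev_decodeRev_of_ne (v : List Letter) (c : ℕ+) (hc : c ≠ 1) :
    onesRev (decodeRev c v) = 0 := by
  induction v generalizing c with
  | nil => simp [decodeRev, onesRev]
  | cons a v ih =>
    cases a with
    | x =>
      rw [decodeRev]
      refine ih _ fun h => ?_
      have := congrArg PNat.val h; have := c.pos; simp at *
    | y => simp [decodeRev, onesRev, hc]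

theorem onesRev_decodeRev (v : List Letter) : onesRev (decodeRev 1 v) = ysRev v := by
  induction v with
  | nil => simp [decodeRev, onesRev, ysRev]
  | cons a v ih =>
    cases a with
    | x =>
      rw [decodeRev, ysRev]
      · exact onesRev_decodeRev_of_ne _ _ (by decide)
      · simp
    | y => simp [decodeRev, onesRev, ysRev, ih]

theorem decodeRev_replicate_append (n : ℕ) (c : ℕ+) (v : List Letter) :
    decodeRev c (List.replicate n Letter.x ++ Letter.y :: v)
      = ⟨(c : ℕ) + n, Nat.add_pos_left c.pos n⟩ :: decodeRev 1 v := by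
  induction n generalizing c with
  | zero => simp only [List.replicate_zero, List.nil_append, decodeRev]; rfl
  | succ n ih =>
    rw [List.replicate_succ, List.cons_append, decodeRev, ih]
    congr 2
    simp only [PNat.add_coe, PNat.one_coe]; omega

theorem decode_word (k : Index) : decode (word k) = k := by
  suffices h : ∀ u : List ℕ+, decodeRev 1 (word u.reverse).reverse = u by
    have := h k.reverse
    rw [List.reverse_reverse] at this
    rw [decode, this, List.reverse_reverse]
  intro u
  induction u with
  | nil => simp [word, decodeRev]
  | cons a u ih =>
    rw [word_reverse_cons, decodeRev_replicate_append, ih]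
    congr 1
    apply PNat.coe_injective
    have := a.pos
    simp only [PNat.mk_coe, PNat.one_coe]; omega

theorem triangular_shuffle : Triangular shuffleProd := by
  intro k
  obtain ⟨R, hR, hR'⟩ := wordShuffleRev_y (word k).reverse
  have h1 : word [1] = [Letter.y] := by simp [word]
  have hones : ysRev (word k).reverse = ones k := by
    rw [← onesRev_decodeRev, ones]
    congr 1
    rw [← List.reverse_reverse (decodeRev 1 _)]
    exact congrArg List.reverse (decode_word k)
  refine ⟨R.map (fun w => decode w.reverse), ?_, ?_⟩
  · have h2 : decode (word k ++ [Letter.y]) = k ++ [1] := by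
      rw [← decode_word (k ++ [1])]; simp [word]
    simp [shuffleProd, wordShuffle, h1, hR, hones, h2]
  · intro h hh
    obtain ⟨w, hw, rfl⟩ := Multiset.mem_map.1 hh
    have := hR' w hw
    rw [hones] at this
    simpa [ones, decode, onesRev_decodeRev] using this

/-- The elements of `ℌ¹` supported on indices with at most `n` trailing `1`s. -/
noncomputable def filt (n : ℕ) : Submodule ℚ H1 := Finsupp.supported ℚ ℚ {k | ones k ≤ n}

theorem z_mem_filt {k : Index} {n : ℕ} (h : ones k ≤ n) : z k ∈ filt n :=
  Finsupp.single_mem_supported ℚ 1 h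

theorem filt_mono {m n : ℕ} (h : m ≤ n) : filt m ≤ filt n :=
  Finsupp.supported_mono fun _ hk => le_trans hk h

theorem ones_append_one (k : Index) : ones (k ++ [1]) = ones k + 1 := by
  simp [ones, onesRev]

theorem mulY_z {P : Index → Index → Multiset Index} (hP : Triangular P) (k : Index) :
    mulY P (z k) - ((ones k : ℚ) + 1) • z (k ++ [1]) ∈ filt (ones k) := by
  obtain ⟨R, hR, hR'⟩ := hP k
  have h1 : mulY P (z k) = ((P k [1]).map z).sum := by
    simp [mulY, mulH1, z]
  rw [h1, hR]
  simp only [Multiset.map_add, Multiset.sum_add, Multiset.map_replicate, Multiset.sum_replicate]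
  rw [← Nat.cast_smul_eq_nsmul ℚ, Nat.cast_add, Nat.cast_one, add_sub_cancel_left]
  refine multiset_sum_mem _ fun w hw => ?_
  obtain ⟨h, hh, rfl⟩ := Multiset.mem_map.1 hw
  exact z_mem_filt (hR' h hh)

theorem filt_induction {n : ℕ} {W : Submodule ℚ H1} (h : ∀ k, ones k ≤ n → z k ∈ W) :
    filt n ≤ W := by
  rw [filt, Finsupp.supported_eq_span_single, Submodule.span_le]
  rintro _ ⟨k, hk, rfl⟩
  exact h k hk

theorem mulY_mem {P : Index → Index → Multiset Index} (hP : Triangular P) (n : ℕ) {w : H1}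
    (hw : w ∈ filt n) : mulY P w ∈ filt (n + 1) := by
  refine filt_induction (W := (filt (n + 1)).comap (mulY P)) (fun k hk => ?_) hw
  have h1 := filt_mono (by omega : ones k ≤ n + 1) (mulY_z hP k)
  have h2 : ((ones k : ℚ) + 1) • z (k ++ [1]) ∈ filt (n + 1) :=
    Submodule.smul_mem _ _ (z_mem_filt (by rw [ones_append_one]; omega))
  simpa using add_mem h1 h2

theorem evalY_single (P : Index → Index → Multiset Index) (i : ℕ) (w : H0) :
    evalY P (Finsupp.single i w) = (mulY P ^ i) (inclH0 w) := by
  simp [evalY]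

theorem mulY_evalY_mem (P : Index → Index → Multiset Index) {w : H1}
    (hw : w ∈ LinearMap.range (evalY P)) : mulY P w ∈ LinearMap.range (evalY P) := by
  obtain ⟨p, rfl⟩ := hw
  induction p using Finsupp.induction_linear with
  | zero => simp
  | add p q hp hq => rw [map_add, map_add]; exact add_mem hp hq
  | single i w =>
    refine ⟨Finsupp.single (i + 1) w, ?_⟩
    rw [evalY_single, evalY_single, pow_succ']
    rfl

theorem evalY_surjective {P : Index → Index → Multiset Index} (hP : Triangular P) :
    Function.Surjective (evalY P) := by
  rw [← LinearMap.range_eq_top, eq_top_iff]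
  have key : ∀ n, filt n ≤ LinearMap.range (evalY P) := by
    intro n
    induction n with
    | zero =>
      refine filt_induction fun k hk => ?_
      refine ⟨Finsupp.single 0 (Finsupp.single ⟨k, (admissible_iff k).2 (by omega)⟩ 1), ?_⟩
      simp [evalY_single, inclH0, z]
    | succ n ih =>
      refine filt_induction fun k hk => ?_
      rcases Nat.lt_or_ge (ones k) (n + 1) with h | h
      · exact ih (z_mem_filt (by omega))
      · obtain ⟨j, rfl⟩ : ∃ j, k = j ++ [1] := by
          induction k using List.reverseRecOn with
          | nil => simp [ones, onesRev] at h
          | append_singleton j a _ =>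
            refine ⟨j, ?_⟩
            by_cases ha : a = 1
            · rw [ha]
            · simp [ones, onesRev, ha] at h
        rw [ones_append_one] at hk h
        have hj : ones j = n := by omega
        have h1 := ih (hj ▸ mulY_z hP j)
        have h2 := mulY_evalY_mem P (ih (z_mem_filt (k := j) hj.le))
        have h3 : ((ones j : ℚ) + 1) • z (j ++ [1]) ∈ LinearMap.range (evalY P) := by
          have := sub_mem h2 h1
          rw [sub_sub_cancel] at this
          rwa [hj]
        exact (Submodule.smul_mem_iff _ (by positivity : ((ones j : ℚ) + 1) ≠ 0)).1 h3
  intro w _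
  induction w using Finsupp.induction_linear with
  | zero => exact zero_mem _
  | add p q hp hq => exact add_mem (hp trivial) (hq trivial)
  | single k c =>
    have : Finsupp.single k c = c • z k := by simp [z]
    rw [this]
    exact Submodule.smul_mem _ _ (key _ (z_mem_filt le_rfl))

theorem inclH0_mem (w : H0) : inclH0 w ∈ filt 0 := by
  induction w using Finsupp.induction_linear with
  | zero => simp
  | add p q hp hq => rw [map_add]; exact add_mem hp hq
  | single k c =>
    have : inclH0 (Finsupp.single k c) = c • z k.1 := by simp [inclH0, z]
    rw [this]
    exact Submodule.smul_mem _ _ (z_mem_filt ((admissible_iff _).1 k.2).le)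

theorem pow_mulY_mem {P : Index → Index → Multiset Index} (hP : Triangular P) (i : ℕ) (w : H0) :
    (mulY P ^ i) (inclH0 w) ∈ filt i := by
  induction i with
  | zero => simpa using inclH0_mem w
  | succ i ih =>
    rw [pow_succ']
    exact mulY_mem hP i ih

theorem apply_eq_zero {n : ℕ} {w : H1} (hw : w ∈ filt n) {k : Index} (hk : n < ones k) :
    w k = 0 := by
  by_contra h
  have h1 : k ∈ w.support := Finsupp.mem_support_iff.2 h
  have h2 : ones k ≤ n := hw h1
  omega

/-- The leading coefficients of `w • y`. -/
theorem mulY_apply {P : Index → Index → Multiset Index} (hP : Triangular P) (n : ℕ) {w : H1}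
    (hw : w ∈ filt n) (k : Index) (hk : ones k = n) :
    mulY P w (k ++ [1]) = ((n : ℚ) + 1) * w k := by
  have hle : filt n ≤ LinearMap.ker
      ((Finsupp.lapply (k ++ [1]) ∘ₗ mulY P) - ((n : ℚ) + 1) • Finsupp.lapply k) := by
    refine filt_induction fun j hj => ?_
    rw [LinearMap.mem_ker]
    have h1 := apply_eq_zero (mulY_z hP j) (k := k ++ [1]) (by rw [ones_append_one]; omega)
    rw [Finsupp.sub_apply, sub_eq_zero] at h1
    simp only [LinearMap.sub_apply, LinearMap.comp_apply, Finsupp.lapply_apply,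
      LinearMap.smul_apply, h1]
    by_cases hjk : j = k
    · subst hjk; simp [z, hk]
    · have : j ++ [1] ≠ k ++ [1] := fun h => hjk (List.append_cancel_right h)
      simp [z, hjk]
  have := hle hw
  simpa [sub_eq_zero] using this

theorem ones_append_replicate (k : Index) (hk : ones k = 0) (i : ℕ) :
    ones (k ++ List.replicate i 1) = i := by
  induction i with
  | zero => simpa using hk
  | succ i ih => rw [List.replicate_succ', ← List.append_assoc, ones_append_one, ih]

theorem pow_mulY_apply {P : Index → Index → Multiset Index} (hP : Triangular P) (i : ℕ) (w : H0)
    (k : {k : Index // Admissible k}) :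
    (mulY P ^ i) (inclH0 w) (k.1 ++ List.replicate i 1) = (i.factorial : ℚ) * w k := by
  have hk := (admissible_iff k.1).1 k.2
  induction i with
  | zero =>
    simp [inclH0, Finsupp.mapDomain_apply Subtype.val_injective]
  | succ i ih =>
    rw [pow_succ', List.replicate_succ', ← List.append_assoc]
    have := mulY_apply hP i (pow_mulY_mem hP i w) _ (ones_append_replicate k.1 hk i)
    rw [ih] at this
    rw [Nat.factorial_succ]
    push_cast
    rw [mul_assoc]
    exact this

theorem evalY_injective {P : Index → Index → Multiset Index} (hP : Triangular P) :
    Function.Injective (evalY P) := by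
  rw [← LinearMap.ker_eq_bot, LinearMap.ker_eq_bot']
  intro p hp
  by_contra hne
  have hs : p.support.Nonempty := Finsupp.support_nonempty_iff.2 hne
  set N := p.support.max' hs with hN
  have hNp : p N ≠ 0 := Finsupp.mem_support_iff.1 (p.support.max'_mem hs)
  apply hNp
  ext k
  have h1 : evalY P p = ∑ i ∈ p.support, (mulY P ^ i) (inclH0 (p i)) := by
    simp [evalY, Finsupp.lsum_apply, Finsupp.sum]
  have h2 := DFunLike.congr_fun (h1.symm.trans hp) (k.1 ++ List.replicate N 1)
  rw [Finsupp.finsetSum_apply, Finset.sum_eq_single N] at h2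
  · rw [pow_mulY_apply hP] at h2
    simpa [Nat.factorial_ne_zero] using h2
  · intro i hi hiN
    have hlt : i < N := lt_of_le_of_ne (p.support.le_max' i hi) hiN
    refine apply_eq_zero (pow_mulY_mem hP i (p i)) ?_
    rwa [ones_append_replicate _ ((admissible_iff k.1).1 k.2)]
  · intro h
    exact absurd (Finsupp.mem_support_iff.2 hNp) h

theorem evalY_bijective {P : Index → Index → Multiset Index} (hP : Triangular P) :
    Function.Bijective (evalY P) :=
  ⟨evalY_injective hP, evalY_surjective hP⟩

/-- The isomorphism `ℌ⁰[y] ≅ ℌ¹`. -/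
noncomputable def polyEquiv {P : Index → Index → Multiset Index} (hP : Triangular P) :
    (ℕ →₀ H0) ≃ₗ[ℚ] H1 :=
  LinearEquiv.ofBijective (evalY P) (evalY_bijective hP)

/-! ### Multiple zeta values and their regularizations -/

/-- `ζ(k) = ∑_{0 < n₁ < ⋯ < n_r} 1 / (n₁^{k₁} ⋯ n_r^{k_r})`; it is used for admissible `k` only. -/
noncomputable def mzv (k : Index) : ℝ :=
  ∑' n : {n : Fin k.length → ℕ+ // StrictMono n},
    ∏ j, (1 : ℝ) / ((n.1 j : ℕ) : ℝ) ^ (k.get j : ℕ)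

/-- The `ℚ`-subalgebra `𝒵` of `ℝ` generated by all multiple zeta values. -/
noncomputable def MZVAlg : Subalgebra ℚ ℝ :=
  Algebra.adjoin ℚ {a | ∃ k : Index, Admissible k ∧ a = mzv k}

/-- The `ℚ`-linear map `Z : ℌ⁰ → 𝒵` with `Z(z_k) = ζ(k)`. -/
noncomputable def zetaMap : H0 →ₗ[ℚ] MZVAlg :=
  Finsupp.linearCombination ℚ fun k =>
    (⟨mzv k.1, Algebra.subset_adjoin ⟨k.1, k.2, rfl⟩⟩ : MZVAlg)

/-- The extension `Z^• : ℌ¹ → 𝒵[T]` of `Z` with `Z^•(y) = T`, i.e.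
`∑ᵢ wᵢ • y • ⋯ • y ↦ ∑ᵢ Z(wᵢ) Tⁱ`. -/
noncomputable def regMap {P : Index → Index → Multiset Index} (hP : Triangular P) (w : H1) :
    Polynomial MZVAlg :=
  ((polyEquiv hP).symm w).sum fun i v => Polynomial.monomial i (zetaMap v)

/-- The harmonic regularized multiple zeta value `ζ^*(k) = ζ^*(k; 0)`. -/
noncomputable def zetaStar (k : Index) : MZVAlg :=
  (regMap triangular_harmonic (z k)).eval 0

/-- The shuffle regularized multiple zeta value `ζ^ш(k) = ζ^ш(k; 0)`. -/
noncomputable def zetaSh (k : Index) : MZVAlg :=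
  (regMap triangular_shuffle (z k)).eval 0

/-! ### `t`-adic symmetric multiple zeta values -/

/-- The `t`-adically convergent sum `∑_l c(l) t^{l₁ + ⋯ + l_s}` over all tuples `l` of `s`
non-negative integers, with coefficients `c(l)` in `R⟦t⟧`: the `n`-th coefficient collects the
finitely many `l` with `l₁ + ⋯ + l_s = m ≤ n`, the others do not contribute to it. -/
noncomputable def tupleSum {R : Type*} [CommRing R] (s : ℕ) (c : (Fin s → ℕ) → PowerSeries R) :
    PowerSeries R :=
  PowerSeries.mk fun n => ∑ m ∈ Finset.range (n + 1),
    ∑ l ∈ Finset.piAntidiag (Finset.univ : Finset (Fin s)) m,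
      PowerSeries.coeff n (c l * PowerSeries.X ^ m)

/-- For a regularization `ζ^•`, the element `ζ^•_Ŝ(k)` of `𝒵⟦t⟧` given by
`∑_{i=0}^r (-1)^{wt k^{[i]}} ζ^•(k_{[i]}) ∑_l b(k^{[i]}; l) ζ^•(rev (k^{[i]} + l)) t^{wt l}`
with `k_{[i]} = (k₁, …, k_i)` and `k^{[i]} = (k_{i+1}, …, k_r)`. -/
noncomputable def symmZeta (reg : Index → MZVAlg) (k : Index) : PowerSeries MZVAlg :=
  ∑ i ∈ Finset.range (k.length + 1),
    (-1) ^ wt (k.drop i) * PowerSeries.C (reg (k.take i)) *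
      tupleSum (k.drop i).length fun l =>
        PowerSeries.C ((bcoeff (k.drop i) l : MZVAlg) * reg (shift (k.drop i) l).reverse)

/-- `ζ^*_Ŝ(k)`. -/
noncomputable def symmZetaStar : Index → PowerSeries MZVAlg := symmZeta zetaStar

/-- `ζ^ш_Ŝ(k)`. -/
noncomputable def symmZetaSh : Index → PowerSeries MZVAlg := symmZeta zetaSh

end TadicMZV

/-!
Both relations are formal consequences of two facts: the regularizations `ζ^*` and `ζ^ш` are
characters of the harmonic and of the shuffle algebra. All identities in `t` are proved coefficient
by coefficient.

*The regularizations are characters* (`regHom_mul`). On `ℌ⁰` this is the double shuffle property of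
multiple zeta values. The truncated sums satisfy the harmonic product formula exactly
(`truncSum_mul`), and one passes to the limit. The multiple polylogarithms, as formal power series,
satisfy the shuffle product formula, because both sides have the same derivative (`polylog_mul`),
and the values at `1` of series with non-negative coefficients are multiplied through Cauchy
products. The extension to `ℌ¹ = ℌ⁰[y]` only uses that the products are commutative and associative,
which is proved for a common generalization, the quasi-shuffle product `qsh q` with `q = 1` and
`q = 0`.

*Harmonic relations.* `ζ^*_Ŝ` is the convolution, for deconcatenation, of `ζ^*` with the map
`z_k ↦ (-1)^{wt k} ∑_l b(k; l) ζ^*(rev (k + l)) t^{wt l}`. The latter is again a character: reversal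
and the sign are automorphisms of the harmonic algebra, and `z_k ↦ ∑_l b(k; l) z_{k+l} t^{wt l}` is
the exponential of `t` times the derivation `deriv` (`sum_bcoeff_shift`, `deriv_qsh`). Convolutions
of characters are characters (`deconc_tmulHom_qsh`).

*Shuffle relations.* On words `y b`, the same exponential is `y b ↦ ∑ₙ y (xⁿ ш b) tⁿ`
(`toWords_dividedPow_deriv`). With the antipode `S(w) = (-1)^{|w|} rev w`, the coefficient of `tⁿ` of
`ζ^ш_Ŝ` becomes a sum over the deconcatenations `w = c · y b` and `w = w · ∅` of
`-L(c) L(y (xⁿ ш S(b)))` and `δ_{n0} L(w)`, where `L` is the character `ζ^ш` (`coeff_symmHom`). For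
`v = y v'`, both sides of the relation are shown to be the sum of `δ_{n0} L(u) L(v)`, of
`-∑ L(c) L(v y (xⁿ ш S(b)))` over `u = c · y b`, and of the same sum with `u` and `v` exchanged. For
the shuffle product `u ш v` this follows from the identity `∑_{v = c d} c ш y (W ш S(d)) = v y W`
(`sum_sh_pre_antipode`), a form of the antipode axiom; for the concatenations on the other side, from
the fact that `∑ₙ xⁿ tⁿ` and `∑ₙ (-x)ⁿ tⁿ` are inverse for `ш` (`sum_sh_xPow`).
-/

namespace TadicMZV

open Finset.HasAntidiagonal (antidiagonal mem_antidiagonal)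

/-! ### The quasi-shuffle algebra on words -/

section QuasiShuffle

variable {α : Type*}

/-- Prepending the letter `a`, as a linear map on the free module on words. -/
noncomputable def pre (a : α) : (List α →₀ ℚ) →ₗ[ℚ] (List α →₀ ℚ) :=
  Finsupp.lmapDomain ℚ ℚ (List.cons a)

/-- Appending the letter `a`. -/
noncomputable def snoc (a : α) : (List α →₀ ℚ) →ₗ[ℚ] (List α →₀ ℚ) :=
  Finsupp.lmapDomain ℚ ℚ (· ++ [a])

/-- Reversal of words. -/
noncomputable def rev : (List α →₀ ℚ) →ₗ[ℚ] (List α →₀ ℚ) :=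
  Finsupp.lmapDomain ℚ ℚ List.reverse

/-- The basis element attached to a word. -/
noncomputable abbrev bw (u : List α) : List α →₀ ℚ := Finsupp.single u 1

@[simp] theorem pre_bw (a : α) (u : List α) : pre a (bw u) = bw (a :: u) := by simp [pre]
@[simp] theorem snoc_bw (a : α) (u : List α) : snoc a (bw u) = bw (u ++ [a]) := by simp [snoc]
@[simp] theorem rev_bw (u : List α) : rev (bw u) = bw u.reverse := by simp [rev]

/-- Linear maps on the free module on words are determined by their values on words. -/
theorem hom_ext {M : Type*} [AddCommMonoid M] [Module ℚ M] {f g : (List α →₀ ℚ) →ₗ[ℚ] M}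
    (h : ∀ u, f (bw u) = g (bw u)) : f = g :=
  Finsupp.lhom_ext' fun u => LinearMap.ext_ring (h u)

theorem hom_ext_apply {M : Type*} [AddCommMonoid M] [Module ℚ M] (f g : (List α →₀ ℚ) →ₗ[ℚ] M)
    (h : ∀ u, f (bw u) = g (bw u)) (P : List α →₀ ℚ) : f P = g P := by rw [hom_ext h]

theorem rev_pre (a : α) (P : List α →₀ ℚ) : rev (pre a P) = snoc a (rev P) :=
  hom_ext_apply (rev ∘ₗ pre a) (snoc a ∘ₗ rev) (fun u => by simp) P

theorem pre_snoc (a b : α) (P : List α →₀ ℚ) : pre a (snoc b P) = snoc b (pre a P) :=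
  hom_ext_apply (pre a ∘ₗ snoc b) (snoc b ∘ₗ pre a) (fun u => by simp) P

variable [AddCommSemigroup α] (q : ℚ)

/-- The quasi-shuffle product of two words over an alphabet with a commutative and associative
contraction `+`, the contracted terms being weighted by `q`:
`a u * b v = a (u * b v) + b (a u * v) + q (a + b) (u * v)`.
It is the harmonic product for `q = 1` and the shuffle product for `q = 0`. -/
noncomputable def qshWord : List α → List α → (List α →₀ ℚ)
  | [], v => bw v
  | a :: u, [] => bw (a :: u)
  | a :: u, b :: v =>
      pre a (qshWord u (b :: v)) + pre b (qshWord (a :: u) v) + q • pre (a + b) (qshWord u v)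
  termination_by u v => u.length + v.length

/-- The bilinear extension of `qshWord`. -/
noncomputable def qsh : (List α →₀ ℚ) →ₗ[ℚ] (List α →₀ ℚ) →ₗ[ℚ] (List α →₀ ℚ) :=
  Finsupp.linearCombination ℚ fun u => Finsupp.linearCombination ℚ fun v => qshWord q u v

theorem qsh_bw (u v : List α) : qsh q (bw u) (bw v) = qshWord q u v := by simp [qsh]

omit [AddCommSemigroup α] in
/-- Bilinear maps on words are determined by their values on pairs of words. -/
theorem hom_ext₂_apply {β : Type*} {M : Type*} [AddCommMonoid M] [Module ℚ M]
    (f g : (List α →₀ ℚ) →ₗ[ℚ] (List β →₀ ℚ) →ₗ[ℚ] M)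
    (h : ∀ u v, f (bw u) (bw v) = g (bw u) (bw v)) (P : List α →₀ ℚ) (Q : List β →₀ ℚ) :
    f P Q = g P Q := by
  have : f = g := hom_ext fun u => hom_ext fun v => h u v
  rw [this]

@[simp] theorem qsh_nil_left (P : List α →₀ ℚ) : qsh q (bw []) P = P :=
  hom_ext_apply (qsh q (bw [])) .id (fun u => by simp [qsh_bw, qshWord]) P

@[simp] theorem qsh_nil_right (P : List α →₀ ℚ) : qsh q P (bw []) = P :=
  hom_ext_apply ((qsh q).flip (bw [])) .id
    (fun u => by cases u <;> simp [qsh_bw, qshWord]) P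

theorem qsh_pre_pre (a b : α) (P Q : List α →₀ ℚ) :
    qsh q (pre a P) (pre b Q)
      = pre a (qsh q P (pre b Q)) + pre b (qsh q (pre a P) Q) + q • pre (a + b) (qsh q P Q) :=
  hom_ext₂_apply ((qsh q).compl₁₂ (pre a) (pre b))
    (((qsh q).compl₁₂ .id (pre b)).compr₂ (pre a) + ((qsh q).compl₁₂ (pre a) .id).compr₂ (pre b)
      + q • (qsh q).compr₂ (pre (a + b)))
    (fun u v => by simp [qsh_bw, qshWord]) P Q

theorem qsh_comm_word (u v : List α) : qsh q (bw u) (bw v) = qsh q (bw v) (bw u) := by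
  induction u, v using qshWord.induct with
  | case1 v => simp
  | case2 a u => simp
  | case3 a u b v ih1 ih2 ih3 =>
    rw [← pre_bw a u, ← pre_bw b v, qsh_pre_pre, qsh_pre_pre, pre_bw, pre_bw, ih1, ih2, ih3,
      add_comm a b, add_comm (pre a _)]

theorem qsh_comm (P Q : List α →₀ ℚ) : qsh q P Q = qsh q Q P := by
  have h := hom_ext₂_apply (qsh q) (qsh q).flip (fun u v => by
    rw [LinearMap.flip_apply, qsh_comm_word]) P Q
  rwa [LinearMap.flip_apply] at h

theorem qsh_assoc_word (n : ℕ) : ∀ u v w : List α, u.length + v.length + w.length ≤ n →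
    qsh q (qsh q (bw u) (bw v)) (bw w) = qsh q (bw u) (qsh q (bw v) (bw w)) := by
  induction n with
  | zero =>
    intro u v w h
    have : u = [] := List.eq_nil_of_length_eq_zero (by omega)
    subst this; simp
  | succ n ih =>
    intro u v w h
    rcases u with _ | ⟨a, u⟩
    · simp
    rcases v with _ | ⟨b, v⟩
    · simp
    rcases w with _ | ⟨c, w⟩
    · simp
    simp only [List.length_cons] at h
    have h1 := ih u (b :: v) (c :: w) (by simp only [List.length_cons]; omega)
    have h2 := ih (a :: u) v (c :: w) (by simp only [List.length_cons]; omega)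
    have h3 := ih (a :: u) (b :: v) w (by simp only [List.length_cons]; omega)
    have h4 := ih u v (c :: w) (by simp only [List.length_cons]; omega)
    have h5 := ih u (b :: v) w (by simp only [List.length_cons]; omega)
    have h6 := ih (a :: u) v w (by simp only [List.length_cons]; omega)
    have h7 := ih u v w (by omega)
    simp only [← pre_bw] at h1 h2 h3 h4 h5 h6 h7 ⊢
    -- the products are expanded in the first letters; the seven terms that arise on either side
    -- are matched by the induction hypotheses
    replace h1 := congrArg (pre a) h1
    replace h2 := congrArg (pre b) h2
    replace h3 := congrArg (pre c) h3
    replace h4 := congrArg (pre (a + b)) h4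
    replace h5 := congrArg (pre (a + c)) h5
    replace h6 := congrArg (pre (b + c)) h6
    replace h7 := congrArg (pre (a + b + c)) h7
    simp only [qsh_pre_pre, map_add, map_smul, LinearMap.add_apply, LinearMap.smul_apply,
      ← add_assoc] at *
    linear_combination (norm := module) h1 + h2 + h3 + q • h4 + q • h5 + q • h6 + (q * q) • h7

theorem qsh_assoc (P Q R : List α →₀ ℚ) : qsh q (qsh q P Q) R = qsh q P (qsh q Q R) := by
  induction P using Finsupp.induction_linear with
  | zero => simp
  | add P P' h h' => simp only [map_add, LinearMap.add_apply, h, h']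
  | single u r =>
    induction Q using Finsupp.induction_linear with
    | zero => simp
    | add P P' h h' => simp only [map_add, LinearMap.add_apply, h, h']
    | single v s =>
      induction R using Finsupp.induction_linear with
      | zero => simp
      | add P P' h h' => simp only [map_add, h, h']
      | single w t =>
        have h := qsh_assoc_word q _ u v w le_rfl
        rw [← Finsupp.smul_single_one u r, ← Finsupp.smul_single_one v s,
          ← Finsupp.smul_single_one w t]
        simp only [map_smul, LinearMap.smul_apply, h]

theorem qsh_left_comm (P Q R : List α →₀ ℚ) : qsh q P (qsh q Q R) = qsh q Q (qsh q P R) := by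
  rw [← qsh_assoc, qsh_comm q P Q, qsh_assoc]

theorem qsh_snoc_snoc_word (a b : α) (n : ℕ) : ∀ u v : List α, u.length + v.length ≤ n →
    qsh q (snoc a (bw u)) (snoc b (bw v))
      = snoc a (qsh q (bw u) (snoc b (bw v))) + snoc b (qsh q (snoc a (bw u)) (bw v))
        + q • snoc (a + b) (qsh q (bw u) (bw v)) := by
  have nilsnoc : ∀ c : α, snoc c (bw []) = pre c (bw []) := fun c => by simp
  have key : ∀ (v : List α) (a b d : α),
      (qsh q (pre a (bw [])) (snoc b (bw v))
        = snoc a (snoc b (bw v)) + snoc b (qsh q (pre a (bw [])) (bw v))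
          + q • snoc (a + b) (bw v)) := by
    intro v a b d
    induction v with
    | nil =>
      rw [nilsnoc, qsh_pre_pre, ← nilsnoc, ← nilsnoc]
      simp only [qsh_nil_left, qsh_nil_right, ← nilsnoc, pre_snoc]
      simp only [nilsnoc, snoc_bw, pre_bw]
      simp
      abel
    | cons c v ih =>
      rw [← pre_bw, ← pre_snoc, qsh_pre_pre, qsh_pre_pre, ih]
      simp only [qsh_nil_left, map_add, map_smul, pre_snoc]
      module
  induction n with
  | zero =>
    intro u v h
    have : u = [] := List.eq_nil_of_length_eq_zero (by omega)
    subst this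
    rw [nilsnoc, key v a b a, qsh_nil_left, qsh_nil_left]
  | succ n ih =>
    intro u v h
    rcases u with _ | ⟨c, u⟩
    · rw [nilsnoc, key v a b a, qsh_nil_left, qsh_nil_left]
    rcases v with _ | ⟨d, v⟩
    · rw [nilsnoc, qsh_comm, key _ b a a, qsh_nil_right, qsh_nil_right, add_comm b a,
        qsh_comm q (pre b _)]
      abel
    simp only [List.length_cons] at h
    have h1 := congrArg (pre c) (ih u (d :: v) (by simp only [List.length_cons]; omega))
    have h2 := congrArg (pre d) (ih (c :: u) v (by simp only [List.length_cons]; omega))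
    have h3 := congrArg (pre (c + d)) (ih u v (by omega))
    simp only [← pre_bw, ← pre_snoc, qsh_pre_pre, map_add, map_smul] at *
    linear_combination (norm := module) h1 + h2 + q • h3

theorem qsh_snoc_snoc (a b : α) (P Q : List α →₀ ℚ) :
    qsh q (snoc a P) (snoc b Q)
      = snoc a (qsh q P (snoc b Q)) + snoc b (qsh q (snoc a P) Q)
        + q • snoc (a + b) (qsh q P Q) :=
  hom_ext₂_apply ((qsh q).compl₁₂ (snoc a) (snoc b))
    (((qsh q).compl₁₂ .id (snoc b)).compr₂ (snoc a)
      + ((qsh q).compl₁₂ (snoc a) .id).compr₂ (snoc b) + q • (qsh q).compr₂ (snoc (a + b)))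
    (fun u v => qsh_snoc_snoc_word q a b _ u v le_rfl) P Q

/-- The quasi-shuffle product is compatible with the reversal of words: it satisfies the same
recursion in the last letters as in the first ones. -/
theorem rev_qsh (P Q : List α →₀ ℚ) : rev (qsh q P Q) = qsh q (rev P) (rev Q) := by
  refine hom_ext₂_apply ((qsh q).compr₂ rev) ((qsh q).compl₁₂ rev rev) (fun u v => ?_) P Q
  simp only [LinearMap.compr₂_apply, LinearMap.compl₁₂_apply]
  induction u, v using qshWord.induct with
  | case1 v => simp
  | case2 a u => simp
  | case3 a u b v ih1 ih2 ih3 =>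
    rw [← pre_bw] at ih1 ih2 ⊢
    rw [← pre_bw b v] at *
    rw [qsh_pre_pre, rev_pre, rev_pre, qsh_snoc_snoc, map_add, map_add, map_smul, rev_pre, rev_pre,
      rev_pre, ih1, ih2, ih3, rev_pre, rev_pre]

/-- Rescaling of words by a multiplicative function of the letters. -/
noncomputable def scale (s : α → ℚ) : (List α →₀ ℚ) →ₗ[ℚ] (List α →₀ ℚ) :=
  Finsupp.linearCombination ℚ fun u => (u.map s).prod • bw u

omit [AddCommSemigroup α] in
theorem scale_bw (s : α → ℚ) (u : List α) : scale s (bw u) = (u.map s).prod • bw u := by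
  simp [scale]

omit [AddCommSemigroup α] in
theorem scale_pre (s : α → ℚ) (a : α) (P : List α →₀ ℚ) :
    scale s (pre a P) = s a • pre a (scale s P) :=
  hom_ext_apply (scale s ∘ₗ pre a) (s a • pre a ∘ₗ scale s)
    (fun u => by
      simp only [LinearMap.comp_apply, LinearMap.smul_apply, pre_bw, scale_bw, List.map_cons,
        List.prod_cons, map_smul, mul_smul]) P

theorem scale_qsh (s : α → ℚ) (hs : ∀ a b, q * s (a + b) = q * (s a * s b))
    (P Q : List α →₀ ℚ) : scale s (qsh q P Q) = qsh q (scale s P) (scale s Q) := by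
  suffices h : ∀ u v, scale s (qsh q (bw u) (bw v)) = qsh q (scale s (bw u)) (scale s (bw v)) by
    have h' := hom_ext₂_apply ((qsh q).compr₂ (scale s)) ((qsh q).compl₁₂ (scale s) (scale s))
      (fun u v => by rw [LinearMap.compr₂_apply, LinearMap.compl₁₂_apply, h]) P Q
    rwa [LinearMap.compr₂_apply, LinearMap.compl₁₂_apply] at h'
  intro u v
  have hnil : scale s (bw []) = bw [] := by simp [scale_bw]
  induction u, v using qshWord.induct with
  | case1 v => rw [hnil, qsh_nil_left, qsh_nil_left]
  | case2 a u => rw [hnil, qsh_nil_right, qsh_nil_right]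
  | case3 a u b v ih1 ih2 ih3 =>
    rw [← pre_bw] at ih1 ih2 ⊢
    rw [← pre_bw b v] at *
    rw [qsh_pre_pre, map_add, map_add, map_smul, scale_pre, scale_pre, scale_pre, ih1, ih2, ih3]
    simp only [scale_pre, map_smul, LinearMap.smul_apply, qsh_pre_pre, smul_add, smul_smul]
    rw [hs]
    module

/-- The convolution `u ↦ ∑_{u = c d} B(c, d)` over the deconcatenations of a word, for a bilinear
map `B`. -/
noncomputable def deconc {M : Type*} [AddCommGroup M] [Module ℚ M]
    (B : (List α →₀ ℚ) →ₗ[ℚ] (List α →₀ ℚ) →ₗ[ℚ] M) : (List α →₀ ℚ) →ₗ[ℚ] M :=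
  Finsupp.linearCombination ℚ fun u =>
    ∑ i ∈ Finset.range (u.length + 1), B (bw (u.take i)) (bw (u.drop i))

section Deconc

variable {M : Type*} [AddCommGroup M] [Module ℚ M]
  (B : (List α →₀ ℚ) →ₗ[ℚ] (List α →₀ ℚ) →ₗ[ℚ] M)

omit [AddCommSemigroup α] in
theorem deconc_bw (u : List α) : deconc B (bw u)
    = ∑ i ∈ Finset.range (u.length + 1), B (bw (u.take i)) (bw (u.drop i)) := by
  simp [deconc]

omit [AddCommSemigroup α] in
theorem deconc_pre (a : α) (P : List α →₀ ℚ) :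
    deconc B (pre a P) = B (bw []) (pre a P) + deconc (B ∘ₗ pre a) P := by
  refine hom_ext_apply (deconc B ∘ₗ pre a) (B (bw []) ∘ₗ pre a + deconc (B ∘ₗ pre a))
    (fun u => ?_) P
  simp only [LinearMap.comp_apply, LinearMap.add_apply, pre_bw, deconc_bw, List.length_cons]
  rw [Finset.sum_range_succ', add_comm]
  simp

/-- Deconcatenation is multiplicative for the quasi-shuffle product. -/
theorem deconc_qsh (u v : List α) :
    deconc B (qsh q (bw u) (bw v))
      = ∑ i ∈ Finset.range (u.length + 1), ∑ j ∈ Finset.range (v.length + 1),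
          B (qsh q (bw (u.take i)) (bw (v.take j))) (qsh q (bw (u.drop i)) (bw (v.drop j))) := by
  induction u, v using qshWord.induct generalizing B with
  | case1 v => simp [deconc_bw]
  | case2 a u => simp [deconc_bw]
  | case3 a u b v ih1 ih2 ih3 =>
    have e : ∀ c (P : List α →₀ ℚ), deconc (B ∘ₗ pre c) P = deconc B (pre c P)
      - B (bw []) (pre c P) := fun c P => by rw [deconc_pre]; abel
    replace ih1 := ih1 (B ∘ₗ pre a)
    replace ih2 := ih2 (B ∘ₗ pre b)
    replace ih3 := ih3 (B ∘ₗ pre (a + b))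
    rw [e] at ih1 ih2 ih3
    have h := qsh_pre_pre q a b (bw u) (bw v)
    simp only [pre_bw] at h
    have h0 := congrArg (B (bw [])) h
    have h1 := congrArg (deconc B) h
    simp only [map_add, map_smul] at h0 h1
    have h2 : ∀ u v, qsh q (bw (a :: u)) (bw (b :: v))
        = pre a (qsh q (bw u) (bw (b :: v))) + pre b (qsh q (bw (a :: u)) (bw v))
          + q • pre (a + b) (qsh q (bw u) (bw v)) := fun u v => by
      simpa only [pre_bw] using qsh_pre_pre q a b (bw u) (bw v)
    rw [h1]
    simp only [List.length_cons, Finset.sum_range_succ' _ (v.length + 1),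
      Finset.sum_range_succ' _ (u.length + 1), List.take_succ_cons, List.drop_succ_cons,
      List.take_zero, List.drop_zero, qsh_nil_left, qsh_nil_right, LinearMap.comp_apply, pre_bw,
      h2, map_add, map_smul, LinearMap.add_apply, LinearMap.smul_apply, Finset.sum_add_distrib,
      ← Finset.smul_sum] at ih1 ih2 ih3 h0 ⊢
    linear_combination (norm := module) ih1 + ih2 + q • ih3

end Deconc

section Convolution

variable {A : Type*} [CommRing A] [Algebra ℚ A]

/-- The bilinear map `(c, d) ↦ f(c) g(d)`. -/
noncomputable def tmulHom (f g : (List α →₀ ℚ) →ₗ[ℚ] A) :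
    (List α →₀ ℚ) →ₗ[ℚ] (List α →₀ ℚ) →ₗ[ℚ] A :=
  (LinearMap.mul ℚ A).compl₁₂ f g

omit [AddCommSemigroup α] in
@[simp] theorem tmulHom_apply (f g : (List α →₀ ℚ) →ₗ[ℚ] A) (P Q : List α →₀ ℚ) :
    tmulHom f g P Q = f P * g Q := by simp [tmulHom]

/-- The convolution of two characters of the quasi-shuffle algebra is a character. -/
theorem deconc_tmulHom_qsh (f g : (List α →₀ ℚ) →ₗ[ℚ] A)
    (hf : ∀ P Q, f (qsh q P Q) = f P * f Q) (hg : ∀ P Q, g (qsh q P Q) = g P * g Q)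
    (u v : List α) :
    deconc (tmulHom f g) (qsh q (bw u) (bw v))
      = deconc (tmulHom f g) (bw u) * deconc (tmulHom f g) (bw v) := by
  rw [deconc_qsh, deconc_bw, deconc_bw, Finset.sum_mul_sum]
  refine Finset.sum_congr rfl fun i _ => Finset.sum_congr rfl fun j _ => ?_
  simp only [tmulHom_apply, hf, hg]
  ring

end Convolution

end QuasiShuffle

theorem sum_map_cons {α : Type*} (a : α) (s : Multiset (List α)) :
    ((s.map (fun w => a :: w)).map bw).sum = pre a (s.map bw).sum := by
  rw [map_multiset_sum, Multiset.map_map, Multiset.map_map]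
  simp

theorem sum_map_reverse {α : Type*} (s : Multiset (List α)) :
    ((s.map List.reverse).map bw).sum = rev (s.map bw).sum := by
  rw [map_multiset_sum, Multiset.map_map, Multiset.map_map]
  simp

theorem sum_harmonicRev (u v : List ℕ+) :
    ((harmonicRev u v).map bw).sum = qsh 1 (bw u) (bw v) := by
  induction u, v using harmonicRev.induct with
  | case1 v => simp [harmonicRev]
  | case2 a u => simp [harmonicRev]
  | case3 a u b v ih1 ih2 ih3 =>
    have h := qsh_pre_pre 1 a b (bw u) (bw v)
    simp only [pre_bw] at h
    rw [harmonicRev, Multiset.map_add, Multiset.map_add, Multiset.sum_add, Multiset.sum_add,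
      sum_map_cons, sum_map_cons, sum_map_cons, ih1, ih2, ih3, h, one_smul]

/-- A commutative and associative operation on the two letters. It plays no role in the shuffle
product, which is the quasi-shuffle product without contracted terms. -/
instance : AddCommSemigroup Letter where
  add _ _ := Letter.x
  add_assoc _ _ _ := rfl
  add_comm _ _ := rfl

theorem sum_wordShuffleRev (u v : List Letter) :
    ((wordShuffleRev u v).map bw).sum = qsh 0 (bw u) (bw v) := by
  induction u, v using wordShuffleRev.induct with
  | case1 v => simp [wordShuffleRev]
  | case2 a u => simp [wordShuffleRev]
  | case3 a u b v ih1 ih2 =>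
    have h := qsh_pre_pre 0 a b (bw u) (bw v)
    simp only [pre_bw] at h
    rw [wordShuffleRev, Multiset.map_add, Multiset.sum_add,
      sum_map_cons, sum_map_cons, ih1, ih2, h, zero_smul, add_zero]

theorem sum_harmonicProd (k l : Index) :
    ((harmonicProd k l).map z).sum = qsh 1 (bw k) (bw l) := by
  have h := sum_map_reverse (harmonicRev k.reverse l.reverse)
  rw [sum_harmonicRev, rev_qsh, rev_bw, rev_bw, List.reverse_reverse, List.reverse_reverse] at h
  exact h

theorem sum_wordShuffle (u v : List Letter) :
    ((wordShuffle u v).map bw).sum = qsh 0 (bw u) (bw v) := by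
  have h := sum_map_reverse (wordShuffleRev u.reverse v.reverse)
  rw [sum_wordShuffleRev, rev_qsh] at h
  simpa [wordShuffle] using h

theorem mulH1_z (P : Index → Index → Multiset Index) (k l : Index) :
    mulH1 P (z k) (z l) = ((P k l).map z).sum := by
  simp [mulH1, z]

theorem mulH1_harmonicProd : mulH1 harmonicProd = qsh 1 := by
  refine hom_ext fun k => hom_ext fun l => ?_
  rw [← sum_harmonicProd]
  exact mulH1_z _ k l

/-- The inclusion `z_k ↦ y x^{k₁-1} ⋯ y x^{k_r-1}` of `ℌ¹` into `ℚ⟨x, y⟩`. -/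
noncomputable def toWords : H1 →ₗ[ℚ] (List Letter →₀ ℚ) := Finsupp.lmapDomain ℚ ℚ word

@[simp] theorem toWords_bw (k : Index) : toWords (bw k) = bw (word k) := by simp [toWords]

theorem toWords_injective : Function.Injective toWords :=
  Finsupp.mapDomain_injective (Function.LeftInverse.injective decode_word)

theorem toWords_mulH1 (v w : H1) :
    toWords (mulH1 shuffleProd v w) = qsh 0 (toWords v) (toWords w) := by
  refine hom_ext₂_apply ((mulH1 shuffleProd).compr₂ toWords) ((qsh 0).compl₁₂ toWords toWords)
    (fun k l => ?_) v w
  simp only [LinearMap.compr₂_apply, LinearMap.compl₁₂_apply, toWords_bw]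
  rw [← sum_wordShuffle, ← map_word_shuffle]
  erw [mulH1_z]
  rw [map_multiset_sum, Multiset.map_map, Multiset.map_map]
  exact congrArg _ (Multiset.map_congr rfl fun h _ => toWords_bw h)

/-! ### Truncated sums and the harmonic product of multiple zeta values -/

/-- The truncated sum `∑_{n₁ < ⋯ < n_r < N} 1 / (n₁^{k₁} ⋯ n_r^{k_r})` over positive integers,
for an index listed from right to left. The summands with `n = 0` vanish, because `1 / 0 = 0`. -/
noncomputable def truncSum : List ℕ+ → ℕ → ℝ
  | [], _ => 1
  | a :: u, N => ∑ n ∈ Finset.range N, 1 / (n : ℝ) ^ (a : ℕ) * truncSum u n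

theorem truncSum_succ (a : ℕ+) (u : List ℕ+) (N : ℕ) :
    truncSum (a :: u) (N + 1) = truncSum (a :: u) N + 1 / (N : ℝ) ^ (a : ℕ) * truncSum u N := by
  simp [truncSum, Finset.sum_range_succ]

theorem truncSum_nonneg (u : List ℕ+) (N : ℕ) : 0 ≤ truncSum u N := by
  induction u generalizing N with
  | nil => simp [truncSum]
  | cons a u ih =>
    exact Finset.sum_nonneg fun n _ => mul_nonneg (by positivity) (ih n)

/-- The truncated sums satisfy the harmonic product formula. -/
theorem truncSum_mul (N : ℕ) (u v : List ℕ+) :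
    truncSum u N * truncSum v N = ((harmonicRev u v).map (truncSum · N)).sum := by
  induction N generalizing u v with
  | zero =>
    rcases u with _ | ⟨a, u⟩
    · simp [harmonicRev, truncSum]
    rcases v with _ | ⟨b, v⟩
    · simp [harmonicRev, truncSum]
    simp [harmonicRev, truncSum, Function.comp_def]
  | succ N ih =>
    rcases u with _ | ⟨a, u⟩
    · simp [harmonicRev, truncSum]
    rcases v with _ | ⟨b, v⟩
    · simp [harmonicRev, truncSum]
    have h := ih (a :: u) (b :: v)
    simp only [harmonicRev, Multiset.map_add, Multiset.sum_add, Multiset.map_map,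
      Function.comp_def] at h ⊢
    simp only [truncSum_succ, Multiset.sum_map_add, Multiset.sum_map_mul_left, ← ih]
    rw [PNat.add_coe, pow_add]
    have e : (1 : ℝ) / ((N : ℝ) ^ (a : ℕ) * (N : ℝ) ^ (b : ℕ))
      = 1 / (N : ℝ) ^ (a : ℕ) * (1 / (N : ℝ) ^ (b : ℕ)) := by rw [one_div_mul_one_div]
    rw [e]
    linear_combination h

/-- The summand of the truncated sums, extended by zero to all tuples. -/
noncomputable def mzvTerm {r : ℕ} (e : Fin r → ℕ+) (n : Fin r → ℕ) : ℝ :=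
  open Classical in if StrictMono n then ∏ j, 1 / (n j : ℝ) ^ (e j : ℕ) else 0

theorem strictMono_snoc {r : ℕ} (n : Fin r → ℕ) (m : ℕ) :
    StrictMono (Fin.snoc n m : Fin (r + 1) → ℕ) ↔ StrictMono n ∧ ∀ j, n j < m := by
  constructor
  · intro h
    refine ⟨fun i j hij => ?_, fun j => ?_⟩
    · simpa using h (Fin.castSucc_lt_castSucc_iff.2 hij)
    · simpa using h (Fin.castSucc_lt_last j)
  · rintro ⟨h, h'⟩ i j hij
    induction j using Fin.lastCases with
    | last =>
      induction i using Fin.lastCases with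
      | last => exact absurd hij (lt_irrefl _)
      | cast i => simpa using h' i
    | cast j =>
      induction i using Fin.lastCases with
      | last => exact absurd hij (not_lt.2 (Fin.le_last _))
      | cast i => simpa using h (Fin.castSucc_lt_castSucc_iff.1 hij)

theorem truncSum_eq_sum {r : ℕ} (e : Fin r → ℕ+) (N : ℕ) :
    truncSum (List.ofFn e).reverse N
      = ∑ n ∈ Fintype.piFinset fun _ : Fin r => Finset.range N, mzvTerm e n := by
  induction r generalizing N with
  | zero =>
    have h : ∀ n : Fin 0 → ℕ, StrictMono n := fun n i => i.elim0
    simp [truncSum, mzvTerm, h]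
  | succ r ih =>
    rw [List.ofFn_succ', List.concat_eq_append, List.reverse_append, List.reverse_singleton,
      List.singleton_append, truncSum]
    simp only [ih, Finset.mul_sum]
    rw [Finset.sum_sigma']
    refine Finset.sum_of_injOn (fun x => Fin.snoc x.2 x.1) ?_ ?_ ?_ ?_
    · rintro ⟨m, n⟩ - ⟨m', n'⟩ - h
      obtain ⟨rfl, rfl⟩ := Fin.snoc_inj.1 h
      rfl
    · rintro ⟨m, n⟩ h
      simp only [Finset.coe_sigma, Set.mem_sigma_iff, Finset.mem_coe, Finset.mem_range,
        Fintype.mem_piFinset] at h ⊢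
      intro j
      induction j using Fin.lastCases with
      | last => simpa using h.1
      | cast j => simpa using (h.2 j).trans h.1
    · intro n hn hn'
      rw [mzvTerm, if_neg]
      intro hmono
      apply hn'
      rw [← Fin.snoc_init_self n, strictMono_snoc] at hmono
      refine ⟨⟨n (Fin.last r), Fin.init n⟩, ?_, Fin.snoc_init_self n⟩
      simp only [Finset.coe_sigma, Set.mem_sigma_iff, Finset.mem_coe, Finset.mem_range,
        Fintype.mem_piFinset] at hn ⊢
      exact ⟨hn _, hmono.2⟩
    · rintro ⟨m, n⟩ h
      simp only [Finset.mem_sigma, Finset.mem_range, Fintype.mem_piFinset] at h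
      rw [mzvTerm, mzvTerm]
      by_cases hn : StrictMono n
      · rw [if_pos hn, if_pos ((strictMono_snoc n m).2 ⟨hn, h.2⟩), Fin.prod_univ_castSucc]
        simp [mul_comm]
      · rw [if_neg hn, if_neg fun h' => hn ((strictMono_snoc n m).1 h').1, mul_zero]

theorem mzvTerm_nonneg {r : ℕ} (e : Fin r → ℕ+) (n : Fin r → ℕ) : 0 ≤ mzvTerm e n := by
  rw [mzvTerm]
  split_ifs
  · exact Finset.prod_nonneg fun j _ => by positivity
  · exact le_rfl

theorem mzv_eq_tsum (k : Index) : mzv k = ∑' n : Fin k.length → ℕ, mzvTerm k.get n := by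
  have hinj : Function.Injective
      (fun (n : {n : Fin k.length → ℕ+ // StrictMono n}) (j : Fin k.length) => (n.1 j : ℕ)) := by
    intro n n' h
    ext j
    simpa using congrFun h j
  rw [mzv, ← hinj.tsum_eq]
  · refine tsum_congr fun n => ?_
    rw [mzvTerm, if_pos]
    exact fun i j hij => n.2 hij
  · intro n hn
    rw [Function.mem_support, mzvTerm] at hn
    split_ifs at hn with h
    · have hpos : ∀ j, 0 < n j := by
        intro j
        by_contra h0
        refine hn (Finset.prod_eq_zero (Finset.mem_univ j) ?_)
        have : n j = 0 := by omega
        rw [this, Nat.cast_zero, zero_pow (k.get j).ne_zero, div_zero]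
      exact ⟨⟨fun j => ⟨n j, hpos j⟩, fun i j hij => h hij⟩, rfl⟩
    · exact absurd rfl hn

/-- If the truncated sums are bounded, then they converge to the multiple zeta value. -/
theorem tendsto_truncSum_of_bounded (k : Index) (c : ℝ) (hc : ∀ N, truncSum k.reverse N ≤ c) :
    Filter.Tendsto (truncSum k.reverse) Filter.atTop (nhds (mzv k)) := by
  have heq : ∀ N, truncSum k.reverse N
      = ∑ n ∈ Fintype.piFinset fun _ : Fin k.length => Finset.range N, mzvTerm k.get n := by
    intro N
    rw [← truncSum_eq_sum, List.ofFn_get]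
  have hmono : Monotone fun N => Fintype.piFinset fun _ : Fin k.length => Finset.range N :=
    fun M N h => Fintype.piFinset_subset _ _ fun _ => Finset.range_mono h
  have hmem : ∀ n : Fin k.length → ℕ, ∃ N,
      n ∈ Fintype.piFinset fun _ : Fin k.length => Finset.range N := by
    intro n
    refine ⟨∑ j, n j + 1, ?_⟩
    simp only [Fintype.mem_piFinset, Finset.mem_range]
    intro j
    exact Nat.lt_succ_of_le (Finset.single_le_sum (fun _ _ => Nat.zero_le _) (Finset.mem_univ j))
  have hlim := Filter.tendsto_atTop_finset_of_monotone hmono hmem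
  have hs : Summable (mzvTerm k.get) := by
    refine summable_of_sum_le (c := c) (mzvTerm_nonneg _) fun s => ?_
    obtain ⟨N, hN⟩ := (hlim.eventually_ge_atTop s).exists
    refine le_trans ?_ (hc N)
    rw [heq]
    exact Finset.sum_le_sum_of_subset_of_nonneg hN fun n _ _ => mzvTerm_nonneg _ n
  rw [mzv_eq_tsum]
  refine (hs.hasSum.comp hlim).congr fun N => ?_
  rw [heq]
  rfl

theorem truncSum_le_sqrt (u : List ℕ+) (N : ℕ) (hN : 1 ≤ N) :
    truncSum u N ≤ 3 ^ u.length * √N := by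
  induction u generalizing N with
  | nil =>
    have : (1 : ℝ) ≤ √N := Real.one_le_sqrt.2 (by exact_mod_cast hN)
    simpa [truncSum] using this
  | cons a u ih =>
    induction N, hN using Nat.le_induction with
    | base =>
      have ha : (0 : ℝ) ^ (a : ℕ) = 0 := zero_pow a.ne_zero
      simp [truncSum, ha]
    | succ N hN ihN =>
      rw [truncSum_succ, List.length_cons, pow_succ]
      rw [List.length_cons, pow_succ] at ihN
      have hN' : (1 : ℝ) ≤ N := by exact_mod_cast hN
      have h1 : 1 / (N : ℝ) ^ (a : ℕ) * truncSum u N ≤ 1 / (N : ℝ) * (3 ^ u.length * √N) := by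
        refine mul_le_mul ?_ (ih N hN) (truncSum_nonneg _ _) (by positivity)
        exact one_div_le_one_div_of_le (by positivity) (le_self_pow₀ hN' a.ne_zero)
      -- `3 (√(N + 1) - √N) = 3 / (√(N + 1) + √N) ≥ 1 / √N`
      have h2 : √(N : ℝ) + 1 / (N : ℝ) * √N / 3 ≤ √((N : ℝ) + 1) := by
        apply Real.le_sqrt_of_sq_le
        have hs : √(N : ℝ) * √(N : ℝ) = N := Real.mul_self_sqrt (by positivity)
        have hinv : 1 / (N : ℝ) * N = 1 := by field_simp
        have hinv' : 1 / (N : ℝ) ≤ 1 := by rw [div_le_one (by positivity)]; exact hN'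
        have : (√(N : ℝ) + 1 / (N : ℝ) * √N / 3) ^ 2
            = N + 2 / 3 * (1 / (N : ℝ) * N) + (1 / (N : ℝ) * N) * (1 / (N : ℝ)) / 9 := by
          linear_combination (1 + 2 / 3 * (1 / (N : ℝ)) + (1 / (N : ℝ)) ^ 2 / 9) * hs
        rw [this, hinv]
        linarith
      have h3 : (0 : ℝ) ≤ 3 ^ u.length := by positivity
      push_cast
      nlinarith [mul_le_mul_of_nonneg_left h2 h3]

theorem truncSum_bounded (a : ℕ+) (u : List ℕ+) (ha : 2 ≤ a) :
    ∃ c, ∀ N, truncSum (a :: u) N ≤ c := by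
  have hs : Summable fun n : ℕ => 3 ^ u.length * (1 / (n : ℝ) ^ (3 / 2 : ℝ)) :=
    (Real.summable_one_div_nat_rpow.2 (by norm_num)).mul_left _
  refine ⟨∑' n : ℕ, 3 ^ u.length * (1 / (n : ℝ) ^ (3 / 2 : ℝ)), fun N => ?_⟩
  refine le_trans ?_ (hs.sum_le_tsum (Finset.range N) fun n _ => by positivity)
  refine Finset.sum_le_sum fun n _ => ?_
  rcases Nat.eq_zero_or_pos n with rfl | hn
  · rw [Nat.cast_zero, zero_pow a.ne_zero, div_zero, zero_mul]
    positivity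
  have hn' : (1 : ℝ) ≤ n := by exact_mod_cast hn
  have ha' : 2 ≤ (a : ℕ) := by exact_mod_cast ha
  calc 1 / (n : ℝ) ^ (a : ℕ) * truncSum u n
      ≤ 1 / (n : ℝ) ^ 2 * (3 ^ u.length * √n) := by
        refine mul_le_mul ?_ (truncSum_le_sqrt u n hn) (truncSum_nonneg _ _) (by positivity)
        exact one_div_le_one_div_of_le (by positivity) (pow_le_pow_right₀ hn' ha')
    _ = 3 ^ u.length * (1 / (n : ℝ) ^ (3 / 2 : ℝ)) := by
        have h : (n : ℝ) ^ 2 = (n : ℝ) ^ (3 / 2 : ℝ) * √n := by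
          rw [Real.sqrt_eq_rpow, ← Real.rpow_add (by positivity), ← Real.rpow_natCast]
          norm_num
        have h1 : √(n : ℝ) ≠ 0 := by positivity
        have h2 : (n : ℝ) ^ (3 / 2 : ℝ) ≠ 0 := by positivity
        rw [h]
        field_simp

theorem tendsto_truncSum (k : Index) (hk : Admissible k) :
    Filter.Tendsto (truncSum k.reverse) Filter.atTop (nhds (mzv k)) := by
  rcases List.eq_nil_or_concat k with rfl | ⟨k, a, rfl⟩
  · exact tendsto_truncSum_of_bounded [] 1 fun N => by simp [truncSum]
  · have ha : 2 ≤ a := hk a (by simp)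
    obtain ⟨c, hc⟩ := truncSum_bounded a k.reverse ha
    exact tendsto_truncSum_of_bounded _ c fun N => by simpa using hc N

theorem onesRev_harmonicRev (u v : List ℕ+) (hu : onesRev u = 0) (hv : onesRev v = 0) :
    ∀ w ∈ harmonicRev u v, onesRev w = 0 := by
  intro w hw
  rcases u with _ | ⟨a, u⟩
  · simp only [harmonicRev, Multiset.mem_singleton] at hw
    rwa [hw]
  rcases v with _ | ⟨b, v⟩
  · simp only [harmonicRev, Multiset.mem_singleton] at hw
    rwa [hw]
  have hab : a + b ≠ 1 := by
    intro h
    have h := congrArg PNat.val h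
    rw [PNat.add_coe, PNat.one_coe] at h
    have := a.pos
    have := b.pos
    omega
  have ha : a ≠ 1 := by rintro rfl; simp [onesRev] at hu
  have hb : b ≠ 1 := by rintro rfl; simp [onesRev] at hv
  simp only [harmonicRev, Multiset.mem_add, Multiset.mem_map] at hw
  rcases hw with (⟨w, -, rfl⟩ | ⟨w, -, rfl⟩) | ⟨w, -, rfl⟩ <;> simp [onesRev, *]

theorem admissible_harmonicProd {k l : Index} (hk : Admissible k) (hl : Admissible l) :
    ∀ h ∈ harmonicProd k l, Admissible h := by
  intro h hh
  rw [admissible_iff] at *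
  obtain ⟨w, hw, rfl⟩ := Multiset.mem_map.1 hh
  rw [ones, List.reverse_reverse]
  exact onesRev_harmonicRev _ _ hk hl w hw

theorem tendsto_multiset_sum {ι : Type*} (s : Multiset ι) (f : ι → ℕ → ℝ) (a : ι → ℝ)
    (h : ∀ i ∈ s, Filter.Tendsto (f i) Filter.atTop (nhds (a i))) :
    Filter.Tendsto (fun N => (s.map fun i => f i N).sum) Filter.atTop (nhds (s.map a).sum) := by
  induction s using Multiset.induction_on with
  | empty => simp
  | cons i s ih =>
    simp only [Multiset.map_cons, Multiset.sum_cons]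
    exact (h i (Multiset.mem_cons_self i s)).add
      (ih fun j hj => h j (Multiset.mem_cons_of_mem hj))

theorem mzv_mul_harmonic {k l : Index} (hk : Admissible k) (hl : Admissible l) :
    mzv k * mzv l = ((harmonicProd k l).map mzv).sum := by
  refine tendsto_nhds_unique ((tendsto_truncSum k hk).mul (tendsto_truncSum l hl)) ?_
  have h := tendsto_multiset_sum (harmonicProd k l) (fun h => truncSum h.reverse) mzv
    fun h hh => tendsto_truncSum h (admissible_harmonicProd hk hl h hh)
  refine h.congr fun N => ?_
  rw [truncSum_mul, harmonicProd, Multiset.map_map]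
  simp

/-! ### Polylogarithms and the shuffle product of multiple zeta values -/

section Polylog

open PowerSeries in
/-- The multiple polylogarithm of a word listed from right to left, as a formal power series:
the iterated primitive for the forms `dz / z` (letter `x`) and `dz / (1 - z)` (letter `y`). It is
used for words that are empty or begin with `y`. -/
noncomputable def polylog : List Letter → PowerSeries ℝ
  | [] => 1
  | Letter.x :: w => mk fun n => coeff n (polylog w) / n
  | Letter.y :: w => mk fun n => (∑ m ∈ Finset.range n, coeff m (polylog w)) / n

open PowerSeries

theorem constantCoeff_polylog_cons (a : Letter) (w : List Letter) :
    coeff 0 (polylog (a :: w)) = 0 := by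
  cases a <;> simp [polylog]

/-- The Euler operator `z d/dz`. -/
noncomputable def euler (f : PowerSeries ℝ) : PowerSeries ℝ := X * derivative ℝ f

theorem coeff_euler (f : PowerSeries ℝ) (n : ℕ) : coeff n (euler f) = n * coeff n f := by
  rcases n with _ | n
  · simp [euler]
  · rw [euler, coeff_succ_X_mul, coeff_derivative]
    push_cast
    ring

theorem euler_mul (f g : PowerSeries ℝ) : euler (f * g) = euler f * g + f * euler g := by
  simp only [euler, Derivation.leibniz, smul_eq_mul]
  ring

theorem euler_sum {ι : Type*} (s : Multiset ι) (f : ι → PowerSeries ℝ) :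
    euler (s.map f).sum = (s.map fun i => euler (f i)).sum := by
  induction s using Multiset.induction_on with
  | empty => simp [euler]
  | cons i s ih =>
    rw [Multiset.map_cons, Multiset.sum_cons, Multiset.map_cons, Multiset.sum_cons, ← ih]
    simp [euler, mul_add]

theorem eq_of_euler_eq {f g : PowerSeries ℝ} (h : euler f = euler g)
    (h0 : coeff 0 f = coeff 0 g) : f = g := by
  ext n
  rcases n with _ | n
  · exact h0
  · have := congrArg (coeff (n + 1)) h
    rw [coeff_euler, coeff_euler] at this
    exact mul_left_cancel₀ (Nat.cast_ne_zero.2 n.succ_ne_zero) this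

/-- The form `z ω` for `ω = dz / z` and `ω = dz / (1 - z)`. -/
noncomputable def form : Letter → PowerSeries ℝ
  | Letter.x => 1
  | Letter.y => X * mk fun _ => 1

theorem euler_polylog_cons (a : Letter) (w : List Letter) (h : GoodRev (a :: w)) :
    euler (polylog (a :: w)) = form a * polylog w := by
  ext n
  rw [coeff_euler]
  cases a with
  | x =>
    rw [form, one_mul, polylog, coeff_mk]
    rcases n with _ | n
    · rcases w with _ | ⟨b, w⟩
      · simp [GoodRev] at h
      · rw [constantCoeff_polylog_cons]
        simp
    · field_simp
  | y =>
    rw [form, polylog, coeff_mk]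
    rcases n with _ | n
    · simp [mul_assoc]
    · rw [mul_assoc, coeff_succ_X_mul, mul_comm (mk _), coeff_mul,
        Finset.Nat.sum_antidiagonal_eq_sum_range_succ_mk]
      simp only [coeff_mk, mul_one]
      field_simp

/-- The shuffle product formula for multiple polylogarithms: both sides have the same derivative,
by induction. -/
theorem polylog_mul (u v : List Letter) (hu : GoodRev u) (hv : GoodRev v) :
    polylog u * polylog v = ((wordShuffleRev u v).map polylog).sum := by
  induction u, v using wordShuffleRev.induct with
  | case1 v => simp [wordShuffleRev, polylog]
  | case2 a u => simp [wordShuffleRev, polylog]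
  | case3 a u b v ih1 ih2 =>
    have h1 := ih1 (goodRev_tail hu) hv
    have h2 := ih2 hu (goodRev_tail hv)
    have hg := goodRev_wordShuffleRev (a :: u) (b :: v) hu hv
    apply eq_of_euler_eq
    · rw [euler_mul, euler_polylog_cons a u hu, euler_polylog_cons b v hv, euler_sum]
      have e : ∀ w ∈ wordShuffleRev (a :: u) (b :: v), euler (polylog w)
          = form (w.headD Letter.x) * polylog w.tail := by
        intro w hw
        rcases w with _ | ⟨c, w⟩
        · exact absurd rfl (wordShuffleRev_ne_nil _ _ (Or.inl (by simp)) _ hw)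
        · rw [euler_polylog_cons c w (hg _ hw)]
          rfl
      rw [Multiset.map_congr rfl e, wordShuffleRev, Multiset.map_add, Multiset.sum_add,
        Multiset.map_map, Multiset.map_map]
      simp only [Function.comp_def, List.headD_cons, List.tail_cons, Multiset.sum_map_mul_left,
        ← h1, ← h2]
      ring
    · have e : ∀ w ∈ wordShuffleRev (a :: u) (b :: v), coeff 0 (polylog w) = 0 := by
        intro w hw
        rcases w with _ | ⟨c, w⟩
        · exact absurd rfl (wordShuffleRev_ne_nil _ _ (Or.inl (by simp)) _ hw)
        · exact constantCoeff_polylog_cons c w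
      rw [map_multiset_sum, Multiset.map_map, Multiset.sum_eq_zero, coeff_zero_eq_constantCoeff_apply,
        map_mul, ← coeff_zero_eq_constantCoeff_apply, constantCoeff_polylog_cons, zero_mul]
      simp only [Multiset.mem_map, Function.comp_apply]
      rintro _ ⟨w, hw, rfl⟩
      exact e w hw

theorem polylog_nonneg (w : List Letter) (n : ℕ) : 0 ≤ coeff n (polylog w) := by
  induction w generalizing n with
  | nil => rw [polylog, coeff_one]; split_ifs <;> simp
  | cons a w ih =>
    cases a with
    | x => rw [polylog, coeff_mk]; exact div_nonneg (ih n) (by positivity)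
    | y =>
      rw [polylog, coeff_mk]
      exact div_nonneg (Finset.sum_nonneg fun m _ => ih m) (by positivity)

theorem coeff_polylog_replicate (m : ℕ) (w : List Letter) (n : ℕ) :
    coeff n (polylog (List.replicate m Letter.x ++ w)) = 1 / (n : ℝ) ^ m * coeff n (polylog w) := by
  induction m with
  | zero => simp
  | succ m ih =>
    rw [List.replicate_succ, List.cons_append, polylog, coeff_mk, ih, pow_succ]
    ring

theorem sum_coeff_polylog (u : List ℕ+) (N : ℕ) (hN : 1 ≤ N) :
    ∑ n ∈ Finset.range N, coeff n (polylog (word u.reverse).reverse) = truncSum u N := by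
  induction u generalizing N with
  | nil =>
    have h : (word (List.reverse [])).reverse = [] := by simp [word]
    simp only [h, polylog, coeff_one, truncSum]
    rw [Finset.sum_ite_eq' (Finset.range N) 0, if_pos (Finset.mem_range.2 hN)]
  | cons a u ih =>
    refine Finset.sum_congr rfl fun n _ => ?_
    rw [word_reverse_cons, coeff_polylog_replicate, polylog, coeff_mk]
    rcases Nat.eq_zero_or_pos n with rfl | hn
    · simp
    · rw [ih n hn]
      obtain ⟨m, hm⟩ : ∃ m, (a : ℕ) = m + 1 := ⟨a - 1, by have := a.pos; omega⟩
      rw [hm, Nat.add_sub_cancel, pow_succ]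
      ring

theorem hasSum_polylog (k : Index) (hk : Admissible k) :
    HasSum (fun n => coeff n (polylog (word k).reverse)) (mzv k) := by
  rw [hasSum_iff_tendsto_nat_of_nonneg fun n => polylog_nonneg _ n]
  refine (tendsto_truncSum k hk).congr' ?_
  filter_upwards [Filter.eventually_ge_atTop 1] with N hN
  rw [← sum_coeff_polylog _ N hN, List.reverse_reverse]

theorem ysRev_wordShuffleRev (u v : List Letter) (hu : ysRev u = 0) (hv : ysRev v = 0) :
    ∀ w ∈ wordShuffleRev u v, ysRev w = 0 := by
  intro w hw
  rcases u with _ | ⟨a, u⟩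
  · simp only [wordShuffleRev, Multiset.mem_singleton] at hw
    rwa [hw]
  rcases v with _ | ⟨b, v⟩
  · simp only [wordShuffleRev, Multiset.mem_singleton] at hw
    rwa [hw]
  simp only [wordShuffleRev, Multiset.mem_add, Multiset.mem_map] at hw
  rcases a with _ | _
  · rcases b with _ | _
    · rcases hw with ⟨w, -, rfl⟩ | ⟨w, -, rfl⟩ <;> simp [ysRev]
    · simp [ysRev] at hv
  · simp [ysRev] at hu

theorem ysRev_word_reverse (k : Index) : ysRev (word k).reverse = ones k := by
  conv_rhs => rw [← decode_word k]
  rw [ones, decode, List.reverse_reverse, onesRev_decodeRev]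

theorem admissible_shuffleProd {k l : Index} (hk : Admissible k) (hl : Admissible l) :
    ∀ h ∈ shuffleProd k l, Admissible h := by
  intro h hh
  rw [admissible_iff] at *
  rw [shuffleProd, wordShuffle, Multiset.map_map] at hh
  obtain ⟨w, hw, rfl⟩ := Multiset.mem_map.1 hh
  rw [Function.comp_apply, ones, decode, List.reverse_reverse, List.reverse_reverse,
    onesRev_decodeRev]
  exact ysRev_wordShuffleRev _ _ ((ysRev_word_reverse k).trans hk)
    ((ysRev_word_reverse l).trans hl) w hw

theorem hasSum_multiset_sum {ι : Type*} (s : Multiset ι) (f : ι → ℕ → ℝ) (a : ι → ℝ)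
    (h : ∀ i ∈ s, HasSum (f i) (a i)) : HasSum (fun n => (s.map fun i => f i n).sum)
      (s.map a).sum := by
  induction s using Multiset.induction_on with
  | empty => simp
  | cons i s ih =>
    simp only [Multiset.map_cons, Multiset.sum_cons]
    exact (h i (Multiset.mem_cons_self i s)).add
      (ih fun j hj => h j (Multiset.mem_cons_of_mem hj))

theorem mzv_mul_shuffle {k l : Index} (hk : Admissible k) (hl : Admissible l) :
    mzv k * mzv l = ((shuffleProd k l).map mzv).sum := by
  have hsk := hasSum_polylog k hk
  have hsl := hasSum_polylog l hl
  have h := hasSum_multiset_sum (shuffleProd k l)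
    (fun h n => coeff n (polylog (word h).reverse)) mzv
    fun h hh => hasSum_polylog h (admissible_shuffleProd hk hl h hh)
  rw [← hsk.tsum_eq, ← hsl.tsum_eq, ← h.tsum_eq,
    tsum_mul_tsum_eq_tsum_sum_antidiagonal_of_summable_norm hsk.summable.norm hsl.summable.norm]
  refine tsum_congr fun n => ?_
  rw [← coeff_mul, polylog_mul, map_multiset_sum, Multiset.map_map]
  · have e := map_word_shuffle k l
    rw [wordShuffle] at e
    have e' := congrArg (Multiset.map fun w => coeff n (polylog w.reverse)) e
    rw [Multiset.map_map, Multiset.map_map] at e'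
    simp only [Function.comp_def, List.reverse_reverse] at e'
    rw [e']
    rfl
  · simpa using goodRev_word_reverse k.reverse
  · simpa using goodRev_word_reverse l.reverse

end Polylog

/-! ### Multiplicativity of the regularizations -/

section Regularization

variable {P : Index → Index → Multiset Index}

/-- The regularized zeta map `ℌ¹ → 𝒵`, the constant term of `regMap`. -/
noncomputable def regHom (hP : Triangular P) : H1 →ₗ[ℚ] MZVAlg :=
  zetaMap ∘ₗ Finsupp.lapply 0 ∘ₗ (polyEquiv hP).symm.toLinearMap

theorem eval_regMap (hP : Triangular P) (w : H1) : (regMap hP w).eval 0 = regHom hP w := by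
  rw [regMap, Finsupp.sum, Polynomial.eval_finsetSum]
  simp only [Polynomial.eval_monomial, regHom, LinearMap.comp_apply, Finsupp.lapply_apply,
    LinearEquiv.coe_coe]
  rw [Finset.sum_eq_single 0]
  · simp
  · intro i _ hi
    rw [zero_pow hi, mul_zero]
  · intro h
    rw [Finsupp.notMem_support_iff.1 h, map_zero, zero_mul]

theorem regHom_pow_mulY (hP : Triangular P) (i : ℕ) (w : H0) :
    regHom hP ((mulY P ^ i) (inclH0 w)) = if i = 0 then zetaMap w else 0 := by
  have h : (polyEquiv hP).symm ((mulY P ^ i) (inclH0 w)) = Finsupp.single i w := by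
    rw [LinearEquiv.symm_apply_eq, ← evalY_single]
    rfl
  rw [regHom, LinearMap.comp_apply, LinearMap.comp_apply, LinearEquiv.coe_coe, h,
    Finsupp.lapply_apply, Finsupp.single_apply]
  split_ifs <;> simp

/-- The multiple zeta values of all basis elements, without regularization. -/
noncomputable def mzvHom : H1 →ₗ[ℚ] ℝ := Finsupp.linearCombination ℚ mzv

theorem mzvHom_inclH0 (w : H0) : mzvHom (inclH0 w) = zetaMap w := by
  have h : mzvHom ∘ₗ inclH0 = MZVAlg.val.toLinearMap ∘ₗ zetaMap := by
    ext k
    simp [mzvHom, inclH0, zetaMap]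
  exact LinearMap.congr_fun h w

theorem exists_inclH0 {w : H1} (hw : w ∈ filt 0) : ∃ w', inclH0 w' = w := by
  have h : filt 0 ≤ LinearMap.range inclH0 := filt_induction fun k hk =>
    ⟨Finsupp.single ⟨k, (admissible_iff k).2 (by omega)⟩ 1, by simp [inclH0, z]⟩
  exact h hw

/-- Induction on `ℌ⁰` along the basis elements. -/
theorem H0_induction {p : H1 → Prop} (h0 : p 0) (hadd : ∀ v w, p v → p w → p (v + w))
    (hsmul : ∀ (c : ℚ) k, Admissible k → p (c • z k)) (w : H0) : p (inclH0 w) := by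
  induction w using Finsupp.induction_linear with
  | zero => simpa using h0
  | add v w hv hw => rw [map_add]; exact hadd _ _ hv hw
  | single k c =>
    have : inclH0 (Finsupp.single k c) = c • z k.1 := by simp [inclH0, z]
    rw [this]
    exact hsmul c k.1 k.2

theorem mul_inclH0_mem
    (hadm : ∀ k l, Admissible k → Admissible l → ∀ h ∈ P k l, Admissible h) (v w : H0) :
    mulH1 P (inclH0 v) (inclH0 w) ∈ filt 0 := by
  refine H0_induction (p := fun v => mulH1 P v (inclH0 w) ∈ filt 0) (by simp)
    (fun v v' h h' => by rw [map_add, LinearMap.add_apply]; exact add_mem h h')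
    (fun c k hk => ?_) v
  refine H0_induction (p := fun w => mulH1 P (c • z k) w ∈ filt 0) (by simp)
    (fun v v' h h' => by rw [map_add]; exact add_mem h h') (fun d l hl => ?_) w
  simp only [map_smul, LinearMap.smul_apply, mulH1_z]
  refine Submodule.smul_mem _ _ (Submodule.smul_mem _ _ (multiset_sum_mem _ fun x hx => ?_))
  obtain ⟨h, hh, rfl⟩ := Multiset.mem_map.1 hx
  exact z_mem_filt ((admissible_iff h).1 (hadm k l hk hl h hh)).le

theorem mzvHom_mul
    (hmul : ∀ k l, Admissible k → Admissible l → mzv k * mzv l = ((P k l).map mzv).sum)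
    (v w : H0) :
    mzvHom (mulH1 P (inclH0 v) (inclH0 w)) = mzvHom (inclH0 v) * mzvHom (inclH0 w) := by
  refine H0_induction
    (p := fun v => mzvHom (mulH1 P v (inclH0 w)) = mzvHom v * mzvHom (inclH0 w)) (by simp)
    (fun v v' h h' => by rw [map_add, LinearMap.add_apply, map_add, map_add, h, h', add_mul])
    (fun c k hk => ?_) v
  refine H0_induction
    (p := fun w => mzvHom (mulH1 P (c • z k) w) = mzvHom (c • z k) * mzvHom w) (by simp)
    (fun v v' h h' => by rw [map_add, map_add, map_add, h, h', mul_add]) (fun d l hl => ?_) w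
  have hz : ∀ k, mzvHom (z k) = mzv k := fun k => by simp [mzvHom, z]
  simp only [map_smul, LinearMap.smul_apply, mulH1_z, hz]
  rw [smul_mul_smul_comm, hmul k l hk hl, map_multiset_sum, Multiset.map_map, smul_smul,
    mul_comm d c]
  simp [hz]

/-- The regularized zeta map is a character, for a commutative and associative product under which
`ℌ⁰` is closed and for which the multiple zeta values are multiplicative. -/
theorem regHom_mul (hP : Triangular P)
    (hcomm : ∀ u v, mulH1 P u v = mulH1 P v u)
    (hassoc : ∀ u v w, mulH1 P (mulH1 P u v) w = mulH1 P u (mulH1 P v w))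
    (hadm : ∀ k l, Admissible k → Admissible l → ∀ h ∈ P k l, Admissible h)
    (hmul : ∀ k l, Admissible k → Admissible l → mzv k * mzv l = ((P k l).map mzv).sum)
    (v w : H1) : regHom hP (mulH1 P v w) = regHom hP v * regHom hP w := by
  have hY : ∀ u v, mulH1 P (mulY P u) v = mulY P (mulH1 P u v) := by
    intro u v
    simp only [mulY, LinearMap.flip_apply]
    rw [hassoc, hcomm (z [1]) v, ← hassoc]
  have hYpow : ∀ i u v, mulH1 P ((mulY P ^ i) u) v = (mulY P ^ i) (mulH1 P u v) := by
    intro i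
    induction i with
    | zero => simp
    | succ i ih =>
      intro u v
      rw [pow_succ', Module.End.mul_apply, hY, ih, Module.End.mul_apply]
  obtain ⟨p, rfl⟩ := evalY_surjective hP v
  obtain ⟨r, rfl⟩ := evalY_surjective hP w
  induction p using Finsupp.induction_linear with
  | zero => simp
  | add p p' h h' => rw [map_add, map_add, LinearMap.add_apply, map_add, map_add, h, h', add_mul]
  | single i v =>
    induction r using Finsupp.induction_linear with
    | zero => simp
    | add p p' h h' => rw [map_add, map_add, map_add, map_add, h, h', mul_add]
    | single j w =>
      obtain ⟨x, hx⟩ := exists_inclH0 (mul_inclH0_mem hadm v w)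
      have hz : zetaMap x = zetaMap v * zetaMap w := by
        apply Subtype.ext
        rw [Subalgebra.coe_mul, ← mzvHom_inclH0, ← mzvHom_inclH0, ← mzvHom_inclH0, hx,
          mzvHom_mul hmul]
      rw [evalY_single, evalY_single, hYpow, hcomm, hYpow, hcomm, ← hx, ← Module.End.mul_apply,
        ← pow_add, regHom_pow_mulY, regHom_pow_mulY, regHom_pow_mulY, hz]
      rcases Nat.eq_zero_or_pos i with rfl | hi
      · by_cases hj : j = 0 <;> simp [hj]
      · rw [if_neg (by omega), if_neg (by omega), zero_mul]

theorem regHom_nil (hP : Triangular P) : regHom hP (bw []) = 1 := by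
  have hadm : Admissible [] := by simp [Admissible]
  have h := regHom_pow_mulY hP 0 (Finsupp.single ⟨[], hadm⟩ 1)
  have h1 : inclH0 (Finsupp.single ⟨[], hadm⟩ 1) = bw [] := by simp [inclH0]
  rw [pow_zero, Module.End.one_apply, h1, if_pos rfl] at h
  rw [h]
  apply Subtype.ext
  have : mzv [] = 1 := by
    have h := tendsto_truncSum [] hadm
    simp only [List.reverse_nil, truncSum] at h
    exact tendsto_nhds_unique h tendsto_const_nhds
  simp [zetaMap, this]

end Regularization

/-- The harmonic regularization as a linear map. -/
noncomputable def starHom : H1 →ₗ[ℚ] MZVAlg := regHom triangular_harmonic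

/-- The shuffle regularization as a linear map. -/
noncomputable def shHom : H1 →ₗ[ℚ] MZVAlg := regHom triangular_shuffle

theorem starHom_bw (k : Index) : starHom (bw k) = zetaStar k := (eval_regMap _ _).symm

theorem shHom_bw (k : Index) : shHom (bw k) = zetaSh k := (eval_regMap _ _).symm

theorem starHom_qsh (v w : H1) : starHom (qsh 1 v w) = starHom v * starHom w := by
  rw [← mulH1_harmonicProd]
  refine regHom_mul _ ?_ ?_ (fun k l hk hl => admissible_harmonicProd hk hl)
    (fun k l hk hl => mzv_mul_harmonic hk hl) v w
  · intro u v
    rw [mulH1_harmonicProd, qsh_comm]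
  · intro u v w
    simp only [mulH1_harmonicProd, qsh_assoc]

theorem shHom_mul (v w : H1) : shHom (mulH1 shuffleProd v w) = shHom v * shHom w := by
  refine regHom_mul _ ?_ ?_ (fun k l hk hl => admissible_shuffleProd hk hl)
    (fun k l hk hl => mzv_mul_shuffle hk hl) v w
  · intro u v
    apply toWords_injective
    rw [toWords_mulH1, toWords_mulH1, qsh_comm]
  · intro u v w
    apply toWords_injective
    simp only [toWords_mulH1, qsh_assoc]

/-! ### Divided powers of derivations -/

section DividedPower

variable {U V W : Type*} [AddCommGroup U] [Module ℚ U] [AddCommGroup V] [Module ℚ V]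
  [AddCommGroup W] [Module ℚ W]

/-- The divided power `Dⁿ / n!` of an endomorphism. -/
noncomputable def dividedPow (D : U →ₗ[ℚ] U) (n : ℕ) : U →ₗ[ℚ] U := (n.factorial : ℚ)⁻¹ • D ^ n

@[simp] theorem dividedPow_zero (D : U →ₗ[ℚ] U) (u : U) : dividedPow D 0 u = u := by
  simp [dividedPow]

theorem dividedPow_comm (f : U →ₗ[ℚ] V) (D : U →ₗ[ℚ] U) (E : V →ₗ[ℚ] V)
    (h : ∀ u, f (D u) = E (f u)) (n : ℕ) (u : U) :
    f (dividedPow D n u) = dividedPow E n (f u) := by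
  have hpow : ∀ u, f ((D ^ n) u) = (E ^ n) (f u) := by
    induction n with
    | zero => simp
    | succ n ih => intro u; rw [pow_succ, pow_succ, Module.End.mul_apply, ih, h]; rfl
  simp [dividedPow, hpow]

theorem dividedPow_unique (D : U →ₗ[ℚ] U) (u : ℕ → U)
    (h : ∀ n, D (u n) = ((n : ℚ) + 1) • u (n + 1)) (n : ℕ) : dividedPow D n (u 0) = u n := by
  induction n with
  | zero => simp
  | succ n ih =>
    have e : dividedPow D (n + 1) (u 0) = ((n : ℚ) + 1)⁻¹ • D (dividedPow D n (u 0)) := by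
      simp only [dividedPow, LinearMap.smul_apply, map_smul, smul_smul, pow_succ',
        Module.End.mul_apply, Nat.factorial_succ]
      push_cast
      rw [mul_inv]
    rw [e, ih, h, smul_smul, inv_mul_cancel₀ (by positivity), one_smul]

/-- The Leibniz rule for divided powers: the exponential of a derivation is multiplicative. -/
theorem dividedPow_bilin (B : U →ₗ[ℚ] V →ₗ[ℚ] W) (D : U →ₗ[ℚ] U) (E : V →ₗ[ℚ] V)
    (F : W →ₗ[ℚ] W) (h : ∀ u v, F (B u v) = B (D u) v + B u (E v)) (n : ℕ) (u : U) (v : V) :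
    dividedPow F n (B u v)
      = ∑ p ∈ antidiagonal n, B (dividedPow D p.1 u) (dividedPow E p.2 v) := by
  have hpow : (F ^ n) (B u v)
      = ∑ p ∈ antidiagonal n, n.choose p.1 • B ((D ^ p.1) u) ((E ^ p.2) v) := by
    induction n with
    | zero => simp
    | succ n ih =>
      rw [Finset.sum_antidiagonal_choose_succ_nsmul
        (M := W) (fun i j => B ((D ^ i) u) ((E ^ j) v)) n, pow_succ', Module.End.mul_apply, ih,
        map_sum, ← Finset.sum_add_distrib]
      refine Finset.sum_congr rfl fun p hp => ?_
      rw [map_nsmul, h, smul_add, pow_succ', pow_succ', Module.End.mul_apply,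
        Module.End.mul_apply, add_comm, Nat.choose_symm_of_eq_add (mem_antidiagonal.1 hp).symm]
  rw [dividedPow, LinearMap.smul_apply, hpow, Finset.smul_sum]
  refine Finset.sum_congr rfl fun p hp => ?_
  rw [mem_antidiagonal] at hp
  simp only [dividedPow, LinearMap.smul_apply, map_smul, smul_smul]
  rw [← Nat.cast_smul_eq_nsmul ℚ, smul_smul]
  congr 1
  have h1 : ((n.choose p.1 : ℚ)) * p.1.factorial * p.2.factorial = n.factorial := by
    have := Nat.choose_mul_factorial_mul_factorial (n := n) (k := p.1) (by omega)
    rw [show n - p.1 = p.2 by omega] at this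
    exact_mod_cast this
  have h2 : (p.1.factorial : ℚ) ≠ 0 := Nat.cast_ne_zero.2 (Nat.factorial_ne_zero _)
  have h3 : (p.2.factorial : ℚ) ≠ 0 := Nat.cast_ne_zero.2 (Nat.factorial_ne_zero _)
  have h4 : (n.factorial : ℚ) ≠ 0 := Nat.cast_ne_zero.2 (Nat.factorial_ne_zero _)
  field_simp
  linear_combination h1

end DividedPower

/-- The value of the derivation `deriv` on a basis element. -/
noncomputable def derivWord : List ℕ+ → H1
  | [] => 0
  | a :: u => (a : ℚ) • bw ((a + 1) :: u) + pre a (derivWord u)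

/-- The linear map `z_k ↦ ∑ⱼ kⱼ z_{(k₁, …, kⱼ + 1, …, k_r)}`, a derivation for the harmonic product;
`exp (t · deriv)` is `z_k ↦ ∑_l b(k; l) z_{k+l} t^{wt l}`. -/
noncomputable def deriv : H1 →ₗ[ℚ] H1 := Finsupp.linearCombination ℚ derivWord

theorem deriv_bw (u : List ℕ+) : deriv (bw u) = derivWord u := by simp [deriv]

theorem deriv_pre (a : ℕ+) (P : H1) :
    deriv (pre a P) = (a : ℚ) • pre (a + 1) P + pre a (deriv P) :=
  hom_ext_apply (deriv ∘ₗ pre a) ((a : ℚ) • pre (a + 1) + pre a ∘ₗ deriv)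
    (fun u => by simp [deriv_bw, derivWord]) P

theorem deriv_nil : deriv (bw []) = 0 := by simp [deriv_bw, derivWord]

theorem deriv_snoc (a : ℕ+) (P : H1) :
    deriv (snoc a P) = (a : ℚ) • snoc (a + 1) P + snoc a (deriv P) := by
  refine hom_ext_apply (deriv ∘ₗ snoc a) ((a : ℚ) • snoc (a + 1) + snoc a ∘ₗ deriv)
    (fun u => ?_) P
  simp only [LinearMap.comp_apply, LinearMap.add_apply, LinearMap.smul_apply]
  induction u with
  | nil => simp [deriv_bw, derivWord]
  | cons b u ih =>
    simp only [← pre_bw, ← pre_snoc, deriv_pre, ih, map_add, map_smul]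
    abel

theorem rev_deriv (P : H1) : rev (deriv P) = deriv (rev P) := by
  refine hom_ext_apply (rev ∘ₗ deriv) (deriv ∘ₗ rev) (fun u => ?_) P
  simp only [LinearMap.comp_apply]
  induction u with
  | nil => simp [deriv_nil]
  | cons a u ih =>
    simp only [← pre_bw, deriv_pre, rev_pre, deriv_snoc, map_add, map_smul, ih]

theorem deriv_qsh (P Q : H1) : deriv (qsh 1 P Q) = qsh 1 (deriv P) Q + qsh 1 P (deriv Q) := by
  suffices h : ∀ u v, deriv (qsh 1 (bw u) (bw v))
      = qsh 1 (deriv (bw u)) (bw v) + qsh 1 (bw u) (deriv (bw v)) from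
    hom_ext₂_apply ((qsh 1).compr₂ deriv)
      ((qsh 1).compl₁₂ deriv .id + (qsh 1).compl₁₂ .id deriv) h P Q
  intro u v
  induction u, v using harmonicRev.induct with
  | case1 v => simp [deriv_nil]
  | case2 a u => simp [deriv_nil]
  | case3 a u b v ih1 ih2 ih3 =>
    replace ih1 := congrArg (pre a) ih1
    replace ih2 := congrArg (pre b) ih2
    replace ih3 := congrArg (pre (a + b)) ih3
    simp only [← pre_bw, qsh_pre_pre, deriv_pre, map_add, map_smul, LinearMap.add_apply,
      LinearMap.smul_apply, one_smul, PNat.add_coe, Nat.cast_add] at ih1 ih2 ih3 ⊢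
    rw [ih1, ih2, ih3, show a + 1 + b = a + b + 1 by rw [add_right_comm],
      show a + (b + 1) = a + b + 1 by rw [add_assoc]]
    module

theorem dividedPow_deriv_nil (n : ℕ) :
    dividedPow deriv n (bw []) = if n = 0 then bw [] else 0 := by
  rcases n with _ | n
  · simp
  · simp [dividedPow, pow_succ, deriv_nil]

/-- The entry `a + i`. -/
def addEntry (a : ℕ+) (i : ℕ) : ℕ+ := ⟨(a : ℕ) + i, Nat.add_pos_left a.pos i⟩

theorem dividedPow_deriv_pre (n : ℕ) (a : ℕ+) (P : H1) :
    dividedPow deriv n (pre a P) = ∑ p ∈ antidiagonal n,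
      (((a : ℕ) + p.1 - 1).choose p.1 : ℚ) • pre (addEntry a p.1) (dividedPow deriv p.2 P) := by
  -- the derivation is the sum of the operator `z_a ↦ a z_{a+1}` on the first letter and of the
  -- derivation on the rest of the word
  set B : (ℕ+ →₀ ℚ) →ₗ[ℚ] H1 →ₗ[ℚ] H1 := Finsupp.linearCombination ℚ pre with hB
  set E : (ℕ+ →₀ ℚ) →ₗ[ℚ] (ℕ+ →₀ ℚ) :=
    Finsupp.linearCombination ℚ fun a => (a : ℚ) • Finsupp.single (a + 1) 1 with hE
  have hBs : ∀ a, B (Finsupp.single a 1) = pre a := fun a => by simp [hB]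
  have hEs : ∀ a : ℕ+, E (Finsupp.single a 1) = (a : ℚ) • Finsupp.single (a + 1) 1 :=
    fun a => by simp [hE]
  have hD : ∀ u v, deriv (B u v) = B (E u) v + B u (deriv v) := by
    intro u v
    induction u using Finsupp.induction_linear with
    | zero => simp
    | add u u' h h' =>
      simp only [map_add, LinearMap.add_apply, h, h']
      abel
    | single a r =>
      rw [← Finsupp.smul_single_one a r]
      simp only [map_smul, LinearMap.smul_apply, hEs, hBs, deriv_pre, smul_add]
  have hpow : ∀ i, dividedPow E i (Finsupp.single a 1)
      = (((a : ℕ) + i - 1).choose i : ℚ) • Finsupp.single (addEntry a i) 1 := by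
    intro i
    have h := dividedPow_unique E
      (fun i => (((a : ℕ) + i - 1).choose i : ℚ) • Finsupp.single (addEntry a i) (1 : ℚ)) ?_ i
    · simp only [Nat.add_zero, Nat.choose_zero_right, Nat.cast_one, one_smul] at h
      exact h
    · intro n
      rw [map_smul, hEs, smul_smul, smul_smul]
      have h1 : addEntry a n + 1 = addEntry a (n + 1) := rfl
      rw [h1]
      congr 1
      obtain ⟨m, hm⟩ : ∃ m, (a : ℕ) = m + 1 := ⟨a - 1, by have := a.pos; omega⟩
      have h2 : ((addEntry a n : ℕ+) : ℕ) = m + n + 1 := by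
        show (a : ℕ) + n = _
        omega
      have h3 := Nat.add_one_mul_choose_eq (m + n) n
      rw [h2, hm, show m + 1 + n - 1 = m + n by omega, show m + 1 + (n + 1) - 1 = m + n + 1 by omega]
      have h4 : ((m : ℚ) + n + 1) * (m + n).choose n = (m + n + 1).choose (n + 1) * (n + 1) := by
        exact_mod_cast h3
      push_cast
      linear_combination h4
  have h := dividedPow_bilin B E deriv deriv hD n (Finsupp.single a 1) P
  rw [hBs] at h
  rw [h]
  refine Finset.sum_congr rfl fun p _ => ?_
  rw [hpow, map_smul, LinearMap.smul_apply, hBs]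

theorem sum_piAntidiag_succ {M : Type*} [AddCommMonoid M] (r n : ℕ) (F : (Fin (r + 1) → ℕ) → M) :
    ∑ l ∈ Finset.piAntidiag (Finset.univ : Finset (Fin (r + 1))) n, F l
      = ∑ p ∈ antidiagonal n,
          ∑ l ∈ Finset.piAntidiag (Finset.univ : Finset (Fin r)) p.2, F (Fin.cons p.1 l) := by
  rw [Finset.sum_sigma']
  symm
  refine Finset.sum_bij' (fun x _ => Fin.cons x.1.1 x.2)
    (fun l _ => ⟨(l 0, ∑ j, Fin.tail l j), Fin.tail l⟩) ?_ ?_ ?_ ?_ ?_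
  · rintro ⟨⟨i, j⟩, l⟩ h
    simp only [Finset.mem_sigma, mem_antidiagonal, Finset.mem_piAntidiag, Finset.mem_univ,
      implies_true, and_true] at h ⊢
    rw [Fin.sum_univ_succ]
    simp [h.1, h.2]
  · intro l h
    simp only [Finset.mem_sigma, mem_antidiagonal, Finset.mem_piAntidiag, Finset.mem_univ,
      implies_true, and_true] at h ⊢
    rw [← h, Fin.sum_univ_succ]
    rfl
  · rintro ⟨⟨i, j⟩, l⟩ h
    simp only [Finset.mem_sigma, mem_antidiagonal, Finset.mem_piAntidiag, Finset.mem_univ,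
      implies_true, and_true] at h
    obtain ⟨-, rfl⟩ := h
    simp
  · intro l _
    simp
  · intro x _
    rfl

/-- The sum `∑_l b(k; l) z_{k+l}` over the tuples `l` of weight `n`. -/
theorem sum_bcoeff_shift (n : ℕ) (k : Index) :
    ∑ l ∈ Finset.piAntidiag (Finset.univ : Finset (Fin k.length)) n,
      (bcoeff k l : ℚ) • (bw (shift k l) : H1) = dividedPow deriv n (bw k) := by
  induction k generalizing n with
  | nil =>
    rw [dividedPow_deriv_nil]
    rcases n with _ | n
    · rw [Finset.piAntidiag_zero]
      have h1 : bcoeff [] (0 : Fin ([] : Index).length → ℕ) = 1 := rfl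
      have h2 : shift [] (0 : Fin ([] : Index).length → ℕ) = [] := rfl
      simp [h1, h2]
    · rw [show (Finset.univ : Finset (Fin ([] : Index).length)) = ∅ from rfl,
        Finset.piAntidiag_empty_of_ne_zero n.succ_ne_zero]
      simp
  | cons a k ih =>
    refine (sum_piAntidiag_succ k.length n _).trans ?_
    rw [← pre_bw, dividedPow_deriv_pre]
    refine Finset.sum_congr rfl fun p _ => ?_
    rw [← ih, map_sum, Finset.smul_sum]
    refine Finset.sum_congr rfl fun l _ => ?_
    have h1 : bcoeff (a :: k) (Fin.cons p.1 l)
        = ((a : ℕ) + p.1 - 1).choose p.1 * bcoeff k l := by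
      rw [bcoeff]
      exact Fin.prod_univ_succ _
    have h2 : shift (a :: k) (Fin.cons p.1 l) = addEntry a p.1 :: shift k l := by
      rw [shift]
      exact List.ofFn_succ
    rw [h1, h2, map_smul, pre_bw, smul_smul, Nat.cast_mul]

/-! ### The harmonic relations -/

/-- A tuple sum, in terms of its coefficients. -/
theorem coeff_tupleSum {R : Type*} [CommRing R] (s : ℕ) (c : (Fin s → ℕ) → PowerSeries R) (n : ℕ) :
    PowerSeries.coeff n (tupleSum s c) = ∑ p ∈ antidiagonal n,
      ∑ l ∈ Finset.piAntidiag (Finset.univ : Finset (Fin s)) p.1, PowerSeries.coeff p.2 (c l) := by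
  rw [tupleSum, PowerSeries.coeff_mk, Finset.Nat.sum_antidiagonal_eq_sum_range_succ_mk]
  refine Finset.sum_congr rfl fun m hm => Finset.sum_congr rfl fun l _ => ?_
  rw [PowerSeries.coeff_mul_X_pow', if_pos (by rw [Finset.mem_range] at hm; omega)]

theorem coeff_tupleSum_C {R : Type*} [CommRing R] (s : ℕ) (c : (Fin s → ℕ) → R) (n : ℕ) :
    PowerSeries.coeff n (tupleSum s fun l => PowerSeries.C (c l))
      = ∑ l ∈ Finset.piAntidiag (Finset.univ : Finset (Fin s)) n, c l := by
  rw [coeff_tupleSum, Finset.sum_eq_single (n, 0)]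
  · simp
  · rintro ⟨i, j⟩ hp hne
    rw [mem_antidiagonal] at hp
    have hj : j ≠ 0 := by rintro rfl; exact hne (by simp at hp; rw [hp])
    simp [PowerSeries.coeff_C, hj]
  · intro h
    exact absurd (mem_antidiagonal.2 (add_zero n)) h

theorem bcoeff_smul (k : Index) (l : Fin k.length → ℕ) (a : MZVAlg) :
    (bcoeff k l : MZVAlg) * a = (bcoeff k l : ℚ) • a := by
  rw [Nat.cast_smul_eq_nsmul, nsmul_eq_mul]

section Symm

variable (f : H1 →ₗ[ℚ] MZVAlg)

/-- The sign `(-1)^{wt k}`, as a rescaling of the basis. -/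
noncomputable abbrev signHom : H1 →ₗ[ℚ] H1 := scale fun a : ℕ+ => (-1) ^ (a : ℕ)

theorem signHom_bw (k : Index) : signHom (bw k) = ((-1) ^ wt k : ℚ) • bw k := by
  rw [signHom, scale_bw]
  congr 1
  induction k with
  | nil => simp [wt]
  | cons a k ih =>
    rw [List.map_cons, List.prod_cons, ih, ← pow_add]
    rfl

/-- The coefficient of `tⁿ` in the second factors of `symmZeta`,
`z_k ↦ (-1)^{wt k} ∑_{wt l = n} b(k; l) f(z_{rev (k + l)})`. -/
noncomputable def dualCoeff (n : ℕ) : H1 →ₗ[ℚ] MZVAlg :=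
  f ∘ₗ rev ∘ₗ dividedPow deriv n ∘ₗ signHom

/-- The generating series of the maps `dualCoeff f n`. -/
noncomputable def dualHom : H1 →ₗ[ℚ] PowerSeries MZVAlg where
  toFun v := PowerSeries.mk fun n => dualCoeff f n v
  map_add' v w := by ext n; simp
  map_smul' c v := by
    ext n
    rw [RingHom.id_apply, map_rat_smul, PowerSeries.coeff_mk, PowerSeries.coeff_mk, map_smul]

theorem coeff_dualHom (n : ℕ) (v : H1) : PowerSeries.coeff n (dualHom f v) = dualCoeff f n v := by
  simp [dualHom]

/-- The map `f`, with values in the constant power series. -/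
noncomputable def constHom : H1 →ₗ[ℚ] PowerSeries MZVAlg where
  toFun v := PowerSeries.C (f v)
  map_add' v w := by simp
  map_smul' c v := by
    rw [RingHom.id_apply, map_smul, map_rat_smul]

theorem constHom_apply (v : H1) : constHom f v = PowerSeries.C (f v) := rfl

theorem dualHom_bw (k : Index) : dualHom f (bw k) = (-1) ^ wt k * tupleSum k.length fun l =>
    PowerSeries.C ((bcoeff k l : MZVAlg) * f (bw (shift k l).reverse)) := by
  ext1 n
  have h : ((-1) ^ wt k : PowerSeries MZVAlg) = PowerSeries.C ((-1) ^ wt k) := by simp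
  rw [coeff_dualHom, h, PowerSeries.coeff_C_mul, coeff_tupleSum_C]
  simp only [dualCoeff, LinearMap.comp_apply, signHom_bw, map_smul]
  rw [← sum_bcoeff_shift, map_sum, map_sum, Finset.smul_sum, Finset.mul_sum]
  refine Finset.sum_congr rfl fun l _ => ?_
  rw [map_smul, map_smul, rev_bw, bcoeff_smul]
  rcases neg_one_pow_eq_or ℚ (wt k) with h | h <;>
    rcases Nat.even_or_odd (wt k) with h' | h' <;> simp [h'.neg_one_pow]

/-- The linear map with values `symmZeta f` on the basis. -/
noncomputable def symmHom : H1 →ₗ[ℚ] PowerSeries MZVAlg :=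
  deconc (tmulHom (constHom f) (dualHom f))

theorem symmHom_bw (k : Index) : symmHom f (bw k) = symmZeta (fun k => f (bw k)) k := by
  rw [symmHom, deconc_bw, symmZeta]
  refine Finset.sum_congr rfl fun i _ => ?_
  rw [tmulHom_apply, dualHom_bw, constHom_apply]
  ring

theorem dualHom_qsh (hf : ∀ P Q, f (qsh 1 P Q) = f P * f Q) (P Q : H1) :
    dualHom f (qsh 1 P Q) = dualHom f P * dualHom f Q := by
  ext1 n
  rw [PowerSeries.coeff_mul, coeff_dualHom]
  have hs := scale_qsh 1 (fun a : ℕ+ => ((-1) ^ (a : ℕ) : ℚ))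
    (fun a b => by rw [PNat.add_coe, pow_add]) P Q
  have hd := dividedPow_bilin (qsh 1) deriv deriv deriv deriv_qsh n (signHom P) (signHom Q)
  rw [dualCoeff, LinearMap.comp_apply, LinearMap.comp_apply, LinearMap.comp_apply, hs, hd, map_sum,
    map_sum]
  refine Finset.sum_congr rfl fun p _ => ?_
  rw [rev_qsh, hf, coeff_dualHom, coeff_dualHom]
  rfl

theorem symmHom_qsh (hf : ∀ P Q, f (qsh 1 P Q) = f P * f Q) (k l : Index) :
    symmHom f (qsh 1 (bw k) (bw l)) = symmHom f (bw k) * symmHom f (bw l) :=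
  deconc_tmulHom_qsh 1 _ _ (fun P Q => by rw [constHom_apply, hf, map_mul]; rfl)
    (dualHom_qsh f hf) k l

end Symm

theorem symmHom_starHom (k : Index) : symmHom starHom (bw k) = symmZetaStar k := by
  rw [symmHom_bw, symmZetaStar]
  congr 1
  exact funext starHom_bw

theorem symmHom_shHom (k : Index) : symmHom shHom (bw k) = symmZetaSh k := by
  rw [symmHom_bw, symmZetaSh]
  congr 1
  exact funext shHom_bw

/-- The harmonic relations. -/
theorem symmZetaStar_harmonicProd (k l : Index) :
    ((harmonicProd k l).map symmZetaStar).sum = symmZetaStar k * symmZetaStar l := by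
  rw [← symmHom_starHom, ← symmHom_starHom, ← symmHom_qsh _ starHom_qsh, ← sum_harmonicProd,
    map_multiset_sum, Multiset.map_map]
  exact congrArg _ (Multiset.map_congr rfl fun h _ => (symmHom_starHom h).symm)

/-- The vector space `ℚ⟨x, y⟩`, through its basis of words. -/
abbrev Words : Type := List Letter →₀ ℚ

/-- The shuffle product on `ℚ⟨x, y⟩`. -/
noncomputable abbrev sh : Words →ₗ[ℚ] Words →ₗ[ℚ] Words := qsh 0

theorem sh_pre_pre (a b : Letter) (P Q : Words) :
    sh (pre a P) (pre b Q) = pre a (sh P (pre b Q)) + pre b (sh (pre a P) Q) := by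
  rw [qsh_pre_pre, zero_smul, add_zero]

/-! ### The antipode of the shuffle algebra -/

/-- The antipode `w ↦ (-1)^{|w|} rev w` of the shuffle algebra. -/
noncomputable def antipode : Words →ₗ[ℚ] Words := rev ∘ₗ scale fun _ => -1

theorem antipode_bw (u : List Letter) : antipode (bw u) = ((-1) ^ u.length : ℚ) • bw u.reverse := by
  rw [antipode, LinearMap.comp_apply, scale_bw, map_smul, rev_bw]
  simp

theorem antipode_nil : antipode (bw []) = bw [] := by simp [antipode_bw]

theorem antipode_antipode (P : Words) : antipode (antipode P) = P := by
  refine hom_ext_apply (antipode ∘ₗ antipode) .id (fun u => ?_) P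
  simp only [LinearMap.comp_apply, antipode_bw, map_smul, List.length_reverse, List.reverse_reverse,
    smul_smul, ← mul_pow, LinearMap.id_apply]
  simp

theorem antipode_pre (a : Letter) (P : Words) : antipode (pre a P) = -snoc a (antipode P) := by
  refine hom_ext_apply (antipode ∘ₗ pre a) (-(snoc a ∘ₗ antipode)) (fun u => ?_) P
  simp only [LinearMap.comp_apply, pre_bw, antipode_bw, LinearMap.neg_apply, map_smul, snoc_bw,
    List.length_cons, List.reverse_cons, pow_succ]
  module

theorem antipode_snoc (a : Letter) (P : Words) : antipode (snoc a P) = -pre a (antipode P) := by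
  refine hom_ext_apply (antipode ∘ₗ snoc a) (-(pre a ∘ₗ antipode)) (fun u => ?_) P
  simp only [LinearMap.comp_apply, pre_bw, antipode_bw, LinearMap.neg_apply, map_smul, snoc_bw,
    List.length_append, List.length_singleton, List.reverse_append, List.reverse_singleton,
    List.singleton_append, pow_succ]
  module

theorem antipode_sh (P Q : Words) : antipode (sh P Q) = sh (antipode P) (antipode Q) := by
  rw [antipode, LinearMap.comp_apply, scale_qsh 0 _ (fun _ _ => by simp), rev_qsh]
  rfl

/-- Moving letters one at a time from the second factor to the first one, the alternating sum of
shuffle products telescopes. -/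
theorem sum_zipper (d p : List Letter) (b : Letter) :
    ∑ i ∈ Finset.range (d.length + 1), ((-1) ^ (d.drop i).length : ℚ) •
        sh (bw ((d.take i).reverse ++ b :: p)) (bw (d.drop i))
      = ((-1) ^ d.length : ℚ) • pre b (sh (bw p) (bw d)) := by
  induction d generalizing p b with
  | nil => simp
  | cons a d ih =>
    rw [List.length_cons, Finset.sum_range_succ']
    simp only [List.take_succ_cons, List.drop_succ_cons, List.reverse_cons, List.append_assoc,
      List.singleton_append, List.take_zero, List.drop_zero, List.reverse_nil, List.nil_append,
      List.length_cons, ih]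
    have h := sh_pre_pre b a (bw p) (bw d)
    simp only [pre_bw] at h
    rw [h, pow_succ]
    module

/-- The defining property of the antipode. -/
theorem sum_sh_antipode (w : List Letter) :
    ∑ i ∈ Finset.range (w.length + 1), sh (bw (w.take i)) (antipode (bw (w.drop i)))
      = if w = [] then bw [] else 0 := by
  rcases w with _ | ⟨a, w⟩
  · simp [antipode_nil]
  rw [if_neg (by simp), List.length_cons, Finset.sum_range_succ']
  have h := congrArg rev (sum_zipper w [] a)
  simp only [map_sum, map_smul, rev_qsh, rev_bw, List.reverse_append, List.reverse_reverse,
    qsh_nil_left, pre_bw, List.reverse_cons, List.reverse_nil, List.nil_append,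
    List.singleton_append] at h
  simp only [List.take_succ_cons, List.drop_succ_cons, antipode_bw, map_smul, h, List.take_zero,
    List.drop_zero, qsh_nil_left, List.length_cons, List.reverse_cons, pow_succ]
  module

/-! ### Concatenation -/

/-- The concatenation product. -/
noncomputable def cat : Words →ₗ[ℚ] Words →ₗ[ℚ] Words :=
  Finsupp.linearCombination ℚ fun u => Finsupp.lmapDomain ℚ ℚ (u ++ ·)

@[simp] theorem cat_bw (u v : List Letter) : cat (bw u) (bw v) = bw (u ++ v) := by simp [cat]

@[simp] theorem cat_nil_left (P : Words) : cat (bw []) P = P :=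
  hom_ext_apply (cat (bw [])) .id (fun u => by simp) P

theorem cat_pre (a : Letter) (P Q : Words) : cat (pre a P) Q = pre a (cat P Q) :=
  hom_ext₂_apply (cat ∘ₗ pre a) (cat.compr₂ (pre a)) (fun u v => by simp) P Q

theorem antipode_cat (P Q : Words) : antipode (cat P Q) = cat (antipode Q) (antipode P) := by
  refine hom_ext₂_apply (cat.compr₂ antipode) (cat.flip.compl₁₂ antipode antipode)
    (fun u v => ?_) P Q
  simp only [LinearMap.compr₂_apply, LinearMap.compl₁₂_apply, LinearMap.flip_apply, antipode_bw,
    cat_bw, map_smul, LinearMap.smul_apply, List.length_append, List.reverse_append, smul_smul,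
    pow_add, mul_comm]

theorem cat_snoc (a : Letter) (P Q : Words) : cat (snoc a P) Q = cat P (pre a Q) :=
  hom_ext₂_apply (cat ∘ₗ snoc a) (cat.compl₂ (pre a)) (fun u v => by simp) P Q

/-! ### Shuffling with powers of `x` -/

/-- The word `xⁿ`. -/
noncomputable def xPow (n : ℕ) : Words := bw (List.replicate n Letter.x)

theorem xPow_zero : xPow 0 = bw [] := rfl

theorem xPow_succ (n : ℕ) : xPow (n + 1) = pre Letter.x (xPow n) := by
  rw [xPow, xPow, pre_bw, List.replicate_succ]

theorem sh_x_xPow (n : ℕ) : sh (xPow 1) (xPow n) = ((n : ℚ) + 1) • xPow (n + 1) := by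
  induction n with
  | zero => simp [xPow_zero]
  | succ n ih =>
    rw [xPow_succ n, xPow_succ 0, sh_pre_pre, ← xPow_succ, ← xPow_succ, ih, xPow_zero, qsh_nil_left,
      map_smul, ← xPow_succ]
    push_cast
    module

theorem dividedPow_sh (n : ℕ) (P : Words) : dividedPow (sh (xPow 1)) n P = sh (xPow n) P := by
  have h := dividedPow_unique (sh (xPow 1)) (fun n => sh (xPow n) P)
    (fun n => by rw [← qsh_assoc, sh_x_xPow, map_smul, LinearMap.smul_apply]) n
  rwa [xPow_zero, qsh_nil_left] at h

theorem sh_x_cat (A B : Words) (c : Letter) :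
    sh (xPow 1) (cat A (pre c B))
      = cat (sh (xPow 1) A) (pre c B) + cat A (pre c (sh (xPow 1) B)) := by
  suffices h : ∀ u : List Letter, sh (xPow 1) (cat (bw u) (pre c B))
      = cat (sh (xPow 1) (bw u)) (pre c B) + cat (bw u) (pre c (sh (xPow 1) B)) by
    have h' := hom_ext_apply (sh (xPow 1) ∘ₗ cat.flip (pre c B))
      (cat.flip (pre c B) ∘ₗ sh (xPow 1) + cat.flip (pre c (sh (xPow 1) B)))
      (fun u => by simpa using h u) A
    simpa using h'
  intro u
  have hx : xPow 1 = pre Letter.x (bw []) := xPow_succ 0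
  induction u with
  | nil => rw [hx, cat_nil_left, sh_pre_pre, qsh_nil_left, qsh_nil_right, cat_pre, cat_nil_left,
      cat_nil_left]
  | cons a u ih =>
    have ih' := congrArg (pre a) ih
    rw [← pre_bw, cat_pre, cat_pre]
    rw [hx] at ih ih' ⊢
    rw [sh_pre_pre, sh_pre_pre, ih, map_add, map_add, LinearMap.add_apply, qsh_nil_left,
      qsh_nil_left, cat_pre, cat_pre, cat_pre]
    abel

theorem sh_xPow_cat (n : ℕ) (A B : Words) (c : Letter) :
    sh (xPow n) (cat A (pre c B)) = ∑ p ∈ antidiagonal n,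
      cat (sh (xPow p.1) A) (pre c (sh (xPow p.2) B)) := by
  have h := dividedPow_bilin (cat.compl₂ (pre c)) (sh (xPow 1)) (sh (xPow 1)) (sh (xPow 1))
    (fun u v => by simpa using sh_x_cat u v c) n A B
  simpa only [LinearMap.compl₂_apply, dividedPow_sh] using h

theorem antipode_xPow (n : ℕ) : antipode (xPow n) = ((-1) ^ n : ℚ) • xPow n := by
  simp [xPow, antipode_bw]

/-- The series `∑ₙ xⁿ tⁿ` is inverse to `∑ₙ (-1)ⁿ xⁿ tⁿ` for the shuffle product. -/
theorem sum_sh_xPow (n : ℕ) (A : Words) :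
    ∑ p ∈ antidiagonal n, ((-1) ^ p.1 : ℚ) • sh (xPow p.2) (sh (xPow p.1) A)
      = if n = 0 then A else 0 := by
  have h := congrArg (fun P => sh P A) (sum_sh_antipode (List.replicate n Letter.x))
  simp only [map_sum, LinearMap.sum_apply] at h
  rw [Finset.Nat.sum_antidiagonal_eq_sum_range_succ_mk, ← Finset.sum_range_reflect]
  rw [List.length_replicate] at h
  convert h using 1
  · refine Finset.sum_congr rfl fun i hi => ?_
    have hi' : i ≤ n := by rw [Finset.mem_range] at hi; omega
    have e := antipode_xPow (n - i)
    rw [xPow] at e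
    rw [List.take_replicate, List.drop_replicate, e, map_smul, map_smul, LinearMap.smul_apply, qsh_assoc,
      min_eq_left hi', show n + 1 - 1 - i = n - i by omega, show n - (n - i) = i by omega]
    rfl
  · rcases n with _ | n
    · simp
    · simp [List.replicate_succ]

theorem sum_antidiagonal_assoc {M : Type*} [AddCommMonoid M] (n : ℕ) (F : ℕ → ℕ → ℕ → M) :
    ∑ p ∈ antidiagonal n, ∑ r ∈ antidiagonal p.2, F p.1 r.1 r.2
      = ∑ p ∈ antidiagonal n, ∑ r ∈ antidiagonal p.1, F r.1 r.2 p.2 := by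
  rw [Finset.sum_sigma', Finset.sum_sigma']
  refine Finset.sum_bij' (fun x _ => ⟨(x.1.1 + x.2.1, x.2.2), (x.1.1, x.2.1)⟩)
    (fun x _ => ⟨(x.2.1, x.2.2 + x.1.2), (x.2.2, x.1.2)⟩) ?_ ?_ ?_ ?_ ?_ <;>
  · rintro ⟨⟨i, j⟩, ⟨k, l⟩⟩ h
    simp only [Finset.mem_sigma, mem_antidiagonal] at h
    obtain ⟨rfl, rfl⟩ := h
    simp [add_assoc]

/-! ### The left derivation and the counit -/

/-- Removal of a leading letter `y`; words that do not begin with `y` are sent to `0`. -/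
noncomputable def leftY : Words →ₗ[ℚ] Words :=
  Finsupp.linearCombination ℚ fun u => match u with
    | Letter.y :: v => bw v
    | _ => 0

theorem leftY_nil : leftY (bw []) = 0 := by simp [leftY]

theorem leftY_pre_y (P : Words) : leftY (pre Letter.y P) = P :=
  hom_ext_apply (leftY ∘ₗ pre Letter.y) .id (fun u => by simp [leftY]) P

theorem leftY_pre_x (P : Words) : leftY (pre Letter.x P) = 0 :=
  hom_ext_apply (leftY ∘ₗ pre Letter.x) 0 (fun u => by simp [leftY]) P

theorem leftY_sh (P Q : Words) : leftY (sh P Q) = sh (leftY P) Q + sh P (leftY Q) := by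
  suffices h : ∀ u v, leftY (sh (bw u) (bw v))
      = sh (leftY (bw u)) (bw v) + sh (bw u) (leftY (bw v)) from
    hom_ext₂_apply (sh.compr₂ leftY) (sh.compl₁₂ leftY .id + sh.compl₁₂ .id leftY) h P Q
  intro u v
  rcases u with _ | ⟨a, u⟩
  · simp [leftY_nil]
  rcases v with _ | ⟨b, v⟩
  · simp [leftY_nil]
  rw [← pre_bw, ← pre_bw b v, sh_pre_pre, map_add]
  cases a <;> cases b <;> simp only [leftY_pre_x, leftY_pre_y, map_zero, LinearMap.zero_apply]

/-- The counit: the coefficient of the empty word. -/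
noncomputable def counit : Words →ₗ[ℚ] ℚ := Finsupp.lapply []

theorem counit_nil : counit (bw []) = 1 := by simp [counit]

theorem counit_pre (a : Letter) (P : Words) : counit (pre a P) = 0 :=
  hom_ext_apply (counit ∘ₗ pre a) 0 (fun u => by simp [counit]) P

theorem counit_sh (P Q : Words) : counit (sh P Q) = counit P * counit Q := by
  suffices h : ∀ u v, counit (sh (bw u) (bw v)) = counit (bw u) * counit (bw v) from
    hom_ext₂_apply (sh.compr₂ counit) ((LinearMap.mul ℚ ℚ).compl₁₂ counit counit)
      (fun u v => by simpa using h u v) P Q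
  intro u v
  rcases u with _ | ⟨a, u⟩
  · simp [counit_nil]
  rcases v with _ | ⟨b, v⟩
  · simp [counit_nil]
  rw [← pre_bw, ← pre_bw b v, sh_pre_pre, map_add]
  simp [counit_pre, -pre_bw]

theorem sum_mul_counit {A : Type*} [CommRing A] [Algebra ℚ A] (f : List Letter → A)
    (u : List Letter) :
    ∑ i ∈ Finset.range (u.length + 1), counit (bw (u.drop i)) • f (u.take i) = f u := by
  rw [Finset.sum_range_succ, Finset.sum_eq_zero, List.drop_length, List.take_length, counit_nil,
    one_smul, zero_add]
  intro i hi
  rw [Finset.mem_range] at hi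
  rw [List.drop_eq_getElem_cons hi, ← pre_bw, counit_pre, zero_smul]

/-- The convolution of the words `c`, for `v = c d`, with `y (W ш S(d))` is the concatenation
`v y W`. -/
theorem sum_sh_pre_antipode (v : List Letter) (W : Words) :
    ∑ j ∈ Finset.range (v.length + 1),
        sh (bw (v.take j)) (pre Letter.y (sh W (antipode (bw (v.drop j)))))
      = cat (bw v) (pre Letter.y W) := by
  induction v with
  | nil => simp [antipode_nil]
  | cons e v ih =>
    have ha := congrArg (fun P => pre Letter.y (sh W P)) (sum_sh_antipode (e :: v))
    rw [List.length_cons, Finset.sum_range_succ', if_neg (by simp)] at ha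
    rw [List.length_cons, Finset.sum_range_succ', ← pre_bw e v, cat_pre, ← ih]
    simp only [List.take_succ_cons, List.drop_succ_cons, List.take_zero, List.drop_zero,
      qsh_nil_left, map_add, map_sum, map_zero] at ha ⊢
    have h : ∀ j, sh (bw (e :: v.take j)) (pre Letter.y (sh W (antipode (bw (v.drop j)))))
        = pre e (sh (bw (v.take j)) (pre Letter.y (sh W (antipode (bw (v.drop j))))))
          + pre Letter.y (sh W (sh (bw (e :: v.take j)) (antipode (bw (v.drop j))))) := by
      intro j
      rw [← pre_bw, sh_pre_pre, qsh_left_comm]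
    simp only [h, Finset.sum_add_distrib]
    linear_combination (norm := module) ha

section Character

variable {A : Type*} [CommRing A] [Algebra ℚ A] (L : Words →ₗ[ℚ] A)

/-- The functional `P ↦ L(y (xⁿ ш S(P)))`. -/
noncomputable def hookHom (n : ℕ) : Words →ₗ[ℚ] A :=
  L ∘ₗ pre Letter.y ∘ₗ sh (xPow n) ∘ₗ antipode

theorem hookHom_apply (n : ℕ) (P : Words) :
    hookHom L n P = L (pre Letter.y (sh (xPow n) (antipode P))) := rfl

/-- The functional that is `δ_{n0}` on the empty word, `-L(y (xⁿ ш S(b)))` on the words `y b`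
and `0` on the words that begin with `x`. -/
noncomputable def cutHom (n : ℕ) : Words →ₗ[ℚ] A :=
  (if n = 0 then (Algebra.linearMap ℚ A) ∘ₗ counit else 0) - hookHom L n ∘ₗ leftY

theorem cutHom_apply (n : ℕ) (P : Words) :
    cutHom L n P = (if n = 0 then counit P • (1 : A) else 0) - hookHom L n (leftY P) := by
  rw [cutHom]
  split_ifs <;> simp [Algebra.algebraMap_eq_smul_one]

/-- The sum of `L(c) · cutHom L n (d)` over the deconcatenations `c d` of a word: the coefficient
of `tⁿ` of the symmetrization of `L`. -/
noncomputable def wordSymm (n : ℕ) : Words →ₗ[ℚ] A := deconc (tmulHom L (cutHom L n))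

/-- Words that are empty or begin with `y`. -/
def Good (u : List Letter) : Prop := u = [] ∨ ∃ v, u = Letter.y :: v

theorem Good.take {u : List Letter} (hu : Good u) (i : ℕ) : Good (u.take i) := by
  rcases hu with rfl | ⟨v, rfl⟩
  · simp [Good]
  · rcases i with _ | i
    · simp [Good]
    · exact Or.inr ⟨v.take i, by simp⟩

theorem good_cons_y (v : List Letter) : Good (Letter.y :: v) := Or.inr ⟨v, rfl⟩

/-- One of the two symmetric halves of the double sums below. -/
noncomputable def halfSum (n : ℕ) (u v : List Letter) : A :=
  ∑ i ∈ Finset.range (u.length + 1), L (bw (u.take i)) *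
    L (cat (bw v) (pre Letter.y (sh (xPow n) (antipode (leftY (bw (u.drop i)))))))

end Character

/-! ### The symmetrization of a character of the shuffle algebra -/

section Character

variable {A : Type*} [CommRing A] [Algebra ℚ A] {L : Words →ₗ[ℚ] A}

theorem map_sh_pre_y (hL : ∀ u v, Good u → Good v → L (sh (bw u) (bw v)) = L (bw u) * L (bw v))
    {u : List Letter} (hu : Good u) (Q : Words) :
    L (sh (bw u) (pre Letter.y Q)) = L (bw u) * L (pre Letter.y Q) :=
  hom_ext_apply (L ∘ₗ sh (bw u) ∘ₗ pre Letter.y)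
    (LinearMap.mulLeft ℚ (L (bw u)) ∘ₗ L ∘ₗ pre Letter.y)
    (fun v => by simpa using hL u (Letter.y :: v) hu (good_cons_y v)) Q

theorem sum_mul_hookHom
    (hL : ∀ u v, Good u → Good v → L (sh (bw u) (bw v)) = L (bw u) * L (bw v))
    (n : ℕ) {v : List Letter} (hv : Good v) (P : Words) :
    ∑ j ∈ Finset.range (v.length + 1), L (bw (v.take j)) * hookHom L n (sh P (bw (v.drop j)))
      = L (cat (bw v) (pre Letter.y (sh (xPow n) (antipode P)))) := by
  rw [← sum_sh_pre_antipode, map_sum]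
  refine Finset.sum_congr rfl fun j _ => ?_
  rw [map_sh_pre_y hL (hv.take j), hookHom_apply, antipode_sh, qsh_assoc]

/-- The symmetrization of a character on a shuffle product. -/
theorem wordSymm_sh (hL : ∀ u v, Good u → Good v → L (sh (bw u) (bw v)) = L (bw u) * L (bw v))
    (n : ℕ) {u v : List Letter} (hu : Good u) (hv : Good v) :
    wordSymm L n (sh (bw u) (bw v))
      = (if n = 0 then L (bw u) * L (bw v) else 0) - halfSum L n u v - halfSum L n v u := by
  have h1 : ∀ i j, tmulHom L (cutHom L n) (sh (bw (u.take i)) (bw (v.take j)))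
        (sh (bw (u.drop i)) (bw (v.drop j)))
      = (if n = 0 then (counit (bw (u.drop i)) • L (bw (u.take i)))
          * (counit (bw (v.drop j)) • L (bw (v.take j))) else 0)
        - L (bw (u.take i)) * (L (bw (v.take j))
          * hookHom L n (sh (leftY (bw (u.drop i))) (bw (v.drop j))))
        - L (bw (v.take j)) * (L (bw (u.take i))
          * hookHom L n (sh (leftY (bw (v.drop j))) (bw (u.drop i)))) := by
    intro i j
    rw [tmulHom_apply, hL _ _ (hu.take i) (hv.take j), cutHom_apply, leftY_sh, counit_sh, map_add,
      qsh_comm 0 (bw (u.drop i))]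
    split_ifs
    · simp only [Algebra.smul_def, map_mul]
      ring
    · ring
  rw [wordSymm, deconc_qsh]
  simp only [h1, Finset.sum_sub_distrib]
  congr 1
  · congr 1
    · split_ifs
      · rw [← Finset.sum_mul_sum, sum_mul_counit (fun u => L (bw u)),
          sum_mul_counit (fun u => L (bw u))]
      · simp
    · refine Finset.sum_congr rfl fun i _ => ?_
      rw [← Finset.mul_sum, sum_mul_hookHom hL n hv]
  · rw [Finset.sum_comm]
    refine Finset.sum_congr rfl fun i _ => ?_
    rw [← Finset.mul_sum, sum_mul_hookHom hL n hu]

theorem sum_antidiagonal_antipode (n : ℕ) (P : Words) :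
    ∑ p ∈ antidiagonal n, sh (xPow p.2) (antipode (sh (xPow p.1) P))
      = if n = 0 then antipode P else 0 := by
  rw [← sum_sh_xPow]
  refine Finset.sum_congr rfl fun p _ => ?_
  rw [antipode_sh, antipode_xPow, map_smul, LinearMap.smul_apply, map_smul]

theorem sum_hookHom_sh (n : ℕ) (P : Words) :
    ∑ p ∈ antidiagonal n, hookHom L p.2 (sh (xPow p.1) P) = if n = 0 then hookHom L 0 P else 0 := by
  simp only [hookHom_apply]
  rw [← map_sum, ← map_sum, sum_antidiagonal_antipode]
  split_ifs
  · rw [xPow_zero, qsh_nil_left]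
  · simp

theorem leftY_xPow (n : ℕ) : leftY (xPow n) = 0 := by
  rcases n with _ | n
  · exact leftY_nil
  · rw [xPow_succ, leftY_pre_x]

theorem counit_xPow (n : ℕ) : counit (xPow n) = if n = 0 then 1 else 0 := by
  rcases n with _ | n
  · exact counit_nil
  · rw [xPow_succ, counit_pre, if_neg (by simp)]

theorem sum_cutHom_sh (n : ℕ) (P : Words) :
    ∑ p ∈ antidiagonal n, cutHom L p.2 (sh (xPow p.1) P) = if n = 0 then cutHom L 0 P else 0 := by
  simp only [cutHom_apply, leftY_sh, leftY_xPow, map_zero, LinearMap.zero_apply, zero_add,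
    Finset.sum_sub_distrib, sum_hookHom_sh, counit_sh, counit_xPow]
  rw [Finset.sum_eq_single (n, 0)]
  · by_cases hn : n = 0 <;> simp [hn]
  · rintro ⟨i, j⟩ hp hne
    rw [mem_antidiagonal] at hp
    have hj : j ≠ 0 := by rintro rfl; exact hne (by simp at hp; rw [hp])
    simp [hj]
  · intro h
    exact absurd (mem_antidiagonal.2 (add_zero n)) h

/-- Shuffling with `xᵐ` on the left and with `xᵖ` on the right of a letter `y`: the alternating
sum keeps only the contributions in which the left part is not modified. -/
theorem sum_sh_cat_sh (n : ℕ) (P Q : Words) :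
    ∑ p ∈ antidiagonal n, ((-1) ^ p.1 : ℚ) •
        sh (xPow p.2) (cat (sh (xPow p.1) P) (pre Letter.y Q))
      = cat P (pre Letter.y (sh (xPow n) Q)) := by
  simp only [sh_xPow_cat, Finset.smul_sum]
  rw [sum_antidiagonal_assoc n fun i j k => ((-1) ^ i : ℚ) •
    cat (sh (xPow j) (sh (xPow i) P)) (pre Letter.y (sh (xPow k) Q))]
  have h : ∀ p : ℕ × ℕ, ∑ r ∈ antidiagonal p.1, ((-1) ^ r.1 : ℚ) •
      cat (sh (xPow r.2) (sh (xPow r.1) P)) (pre Letter.y (sh (xPow p.2) Q))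
      = if p.1 = 0 then cat P (pre Letter.y (sh (xPow p.2) Q)) else 0 := by
    intro p
    have h := congrArg (fun R => cat R (pre Letter.y (sh (xPow p.2) Q))) (sum_sh_xPow p.1 P)
    simp only [map_sum, LinearMap.sum_apply, map_smul, LinearMap.smul_apply] at h
    rw [h]
    split_ifs <;> simp
  simp only [h]
  rw [Finset.sum_eq_single (0, n)]
  · simp
  · rintro ⟨i, j⟩ hp hne
    rw [mem_antidiagonal] at hp
    have hi : i ≠ 0 := by rintro rfl; exact hne (by simp at hp; rw [hp])
    simp [hi]
  · intro h
    exact absurd (mem_antidiagonal.2 (zero_add n)) h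

theorem deconc_cat_pre {M : Type*} [AddCommGroup M] [Module ℚ M]
    (B : Words →ₗ[ℚ] Words →ₗ[ℚ] M) (u : List Letter) (a : Letter) (Q : Words) :
    deconc B (cat (bw u) (pre a Q))
      = ∑ i ∈ Finset.range (u.length + 1), B (bw (u.take i)) (cat (bw (u.drop i)) (pre a Q))
        + deconc (B ∘ₗ cat (bw u) ∘ₗ pre a) Q := by
  induction u generalizing B with
  | nil =>
    have e : B ∘ₗ cat (bw []) ∘ₗ pre a = B ∘ₗ pre a :=
      LinearMap.ext fun v => by simp only [LinearMap.comp_apply, cat_nil_left]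
    rw [cat_nil_left, deconc_pre, e]
    simp
  | cons c u ih =>
    have e : (B ∘ₗ pre c) ∘ₗ cat (bw u) ∘ₗ pre a = B ∘ₗ cat (bw (c :: u)) ∘ₗ pre a :=
      LinearMap.ext fun v => by simp only [LinearMap.comp_apply, ← pre_bw c u, cat_pre]
    rw [← pre_bw, cat_pre, deconc_pre, ih, e, pre_bw, List.length_cons,
      Finset.sum_range_succ' _ (u.length + 1),
      ← cat_pre, pre_bw]
    simp only [LinearMap.comp_apply, pre_bw, List.take_succ_cons, List.drop_succ_cons,
      List.take_zero, List.drop_zero]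
    abel

/-- The contribution of the cuts to the left of the middle letter `y`. -/
theorem sum_cutHom_cat (n : ℕ) (d v : List Letter) :
    ∑ p ∈ antidiagonal n, cutHom L p.2
        (cat (bw d) (pre Letter.y (sh (xPow p.1) (antipode (bw v)))))
      = L (cat (bw (Letter.y :: v)) (pre Letter.y (sh (xPow n) (antipode (leftY (bw d))))))
        - if n = 0 then counit (bw d) • L (bw (Letter.y :: v)) else 0 := by
  rcases d with _ | ⟨a, d⟩
  · simp only [cat_nil_left, cutHom_apply, counit_pre, zero_smul, ite_self, zero_sub, leftY_pre_y,
      Finset.sum_neg_distrib, sum_hookHom_sh, leftY_nil, map_zero, counit_nil, one_smul]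
    congr 1
    rw [hookHom_apply, antipode_antipode, xPow_zero, qsh_nil_left, pre_bw]
  simp only [← pre_bw, cat_pre, cutHom_apply, counit_pre, zero_smul, ite_self, zero_sub, sub_zero]
  cases a with
  | x => simp [leftY_pre_x, -pre_bw]
  | y =>
    simp only [leftY_pre_y, hookHom_apply, antipode_cat, antipode_pre,
      map_neg, LinearMap.neg_apply, cat_snoc, neg_neg]
    rw [← sum_sh_cat_sh n (bw v), map_sum, map_sum]
    simp only [antipode_sh, antipode_antipode, antipode_xPow, map_smul, LinearMap.smul_apply]

theorem deconc_antipode {M : Type*} [AddCommGroup M] [Module ℚ M]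
    (B : Words →ₗ[ℚ] Words →ₗ[ℚ] M) (v : List Letter) :
    deconc B (antipode (bw v)) = ∑ i ∈ Finset.range (v.length + 1),
      B (antipode (bw (v.drop i))) (antipode (bw (v.take i))) := by
  rw [antipode_bw, map_smul, deconc_bw, Finset.smul_sum, ← Finset.sum_range_reflect,
    List.length_reverse]
  refine Finset.sum_congr rfl fun i hi => ?_
  have hi' : i ≤ v.length := by rw [Finset.mem_range] at hi; omega
  rw [show v.length + 1 - 1 - i = v.length - i by omega, List.take_reverse, List.drop_reverse,
    show v.length - (v.length - i) = i by omega, antipode_bw, antipode_bw, map_smul, map_smul,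
    LinearMap.smul_apply, smul_smul, ← pow_add, ← List.length_append,
    List.take_append_drop]

/-- The contribution of the cuts to the right of the middle letter `y`. -/
theorem deconc_cutHom_antipode (hnil : L (bw []) = 1) (f : Words →ₗ[ℚ] A) (v : List Letter) :
    deconc (tmulHom f (cutHom L 0)) (antipode (bw v))
      = ∑ j ∈ Finset.range ((Letter.y :: v).length + 1),
          L (bw ((Letter.y :: v).take j))
            * f (antipode (leftY (bw ((Letter.y :: v).drop j)))) := by
  rw [deconc_antipode, List.length_cons, Finset.sum_range_succ', Finset.sum_range_succ',
    Finset.sum_range_succ]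
  simp only [tmulHom_apply, List.take_succ_cons, List.drop_succ_cons, List.take_zero,
    List.drop_zero, List.drop_length, hnil, leftY_nil, map_zero, mul_zero, add_zero, one_mul]
  congr 1
  · refine Finset.sum_congr rfl fun i hi => ?_
    rw [Finset.mem_range] at hi
    rw [List.drop_eq_getElem_cons hi, List.take_add_one, List.getElem?_eq_getElem hi]
    generalize v[i] = c
    rw [Option.toList_some, ← snoc_bw, ← pre_bw, ← pre_bw, antipode_snoc, map_neg, mul_comm,
      cutHom_apply, counit_pre]
    cases c with
    | x => simp [leftY_pre_x, -pre_bw]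
    | y =>
      rw [leftY_pre_y, leftY_pre_y, hookHom_apply, antipode_antipode, xPow_zero, qsh_nil_left]
      simp
  · rw [antipode_nil, cutHom_apply, counit_nil, leftY_nil, if_pos rfl, map_zero, one_smul, sub_zero,
      mul_one, ← pre_bw, leftY_pre_y]

theorem sum_deconc_sh_xPow (n : ℕ) (f : Words →ₗ[ℚ] A) (Q : Words) :
    ∑ p ∈ antidiagonal n, deconc (tmulHom f (cutHom L p.2)) (sh (xPow p.1) Q)
      = deconc (tmulHom (f ∘ₗ sh (xPow n)) (cutHom L 0)) Q := by
  suffices h : ∀ u, ∑ p ∈ antidiagonal n, deconc (tmulHom f (cutHom L p.2)) (sh (xPow p.1) (bw u))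
      = deconc (tmulHom (f ∘ₗ sh (xPow n)) (cutHom L 0)) (bw u) by
    have h' := hom_ext_apply
      (∑ p ∈ antidiagonal n, deconc (tmulHom f (cutHom L p.2)) ∘ₗ sh (xPow p.1))
      (deconc (tmulHom (f ∘ₗ sh (xPow n)) (cutHom L 0)))
      (fun u => by simpa [LinearMap.sum_apply] using h u) Q
    simpa [LinearMap.sum_apply] using h'
  intro u
  have h1 : ∀ p : ℕ × ℕ, deconc (tmulHom f (cutHom L p.2)) (sh (xPow p.1) (bw u))
      = ∑ r ∈ antidiagonal p.1, ∑ j ∈ Finset.range (u.length + 1),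
          f (sh (xPow r.1) (bw (u.take j))) * cutHom L p.2 (sh (xPow r.2) (bw (u.drop j))) := by
    intro p
    rw [xPow, deconc_qsh, Finset.Nat.sum_antidiagonal_eq_sum_range_succ_mk, List.length_replicate]
    refine Finset.sum_congr rfl fun i hi => Finset.sum_congr rfl fun j _ => ?_
    have hi' : i ≤ p.1 := by rw [Finset.mem_range] at hi; omega
    rw [tmulHom_apply, List.take_replicate, List.drop_replicate, min_eq_left hi']
    rfl
  simp only [h1]
  rw [← sum_antidiagonal_assoc n fun i j k => ∑ l ∈ Finset.range (u.length + 1),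
    f (sh (xPow i) (bw (u.take l))) * cutHom L k (sh (xPow j) (bw (u.drop l))),
    Finset.sum_eq_single (n, 0)]
  · simp [deconc_bw, xPow_zero]
  · rintro ⟨i, j⟩ hp hne
    rw [mem_antidiagonal] at hp
    have hj : j ≠ 0 := by rintro rfl; exact hne (by simp at hp; rw [hp])
    rw [Finset.sum_comm]
    refine Finset.sum_eq_zero fun l _ => ?_
    rw [← Finset.mul_sum, sum_cutHom_sh, if_neg hj, mul_zero]
  · intro h
    exact absurd (mem_antidiagonal.2 (add_zero n)) h

/-- The shuffle relation, for words. -/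
theorem wordSymm_shuffle
    (hL : ∀ u v, Good u → Good v → L (sh (bw u) (bw v)) = L (bw u) * L (bw v))
    (hnil : L (bw []) = 1) (n : ℕ) {u : List Letter} (hu : Good u) (v : List Letter) :
    wordSymm L n (sh (bw u) (bw (Letter.y :: v)))
      = -∑ p ∈ antidiagonal n, wordSymm L p.2
          (cat (bw u) (pre Letter.y (sh (xPow p.1) (antipode (bw v))))) := by
  have hB : ∀ p, tmulHom L (cutHom L p) ∘ₗ cat (bw u) ∘ₗ pre Letter.y
      = tmulHom (L ∘ₗ cat (bw u) ∘ₗ pre Letter.y) (cutHom L p) :=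
    fun p => LinearMap.ext fun P => LinearMap.ext fun Q => by
      simp only [LinearMap.comp_apply, tmulHom_apply]
  rw [wordSymm_sh hL n hu (good_cons_y v)]
  simp only [wordSymm, deconc_cat_pre, hB, Finset.sum_add_distrib, sum_deconc_sh_xPow]
  rw [deconc_cutHom_antipode hnil, Finset.sum_comm]
  simp only [tmulHom_apply, ← Finset.mul_sum, sum_cutHom_cat, mul_sub, Finset.sum_sub_distrib]
  have h : ∑ i ∈ Finset.range (u.length + 1), L (bw (u.take i))
        * (if n = 0 then counit (bw (u.drop i)) • L (bw (Letter.y :: v)) else 0)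
      = if n = 0 then L (bw u) * L (bw (Letter.y :: v)) else 0 := by
    split_ifs
    · rw [← sum_mul_counit (fun u => L (bw u)) u, Finset.sum_mul]
      refine Finset.sum_congr rfl fun i _ => ?_
      rw [mul_smul_comm, smul_mul_assoc]
    · simp
  rw [h]
  simp only [halfSum, LinearMap.comp_apply]
  ring

end Character

/-! ### The shuffle relations -/

theorem word_cons (a : ℕ+) (k : Index) :
    word (a :: k) = Letter.y :: (List.replicate ((a : ℕ) - 1) Letter.x ++ word k) := by
  simp [word]

theorem word_append (k l : Index) : word (k ++ l) = word k ++ word l := by simp [word]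

theorem wt_cons (a : ℕ+) (k : Index) : wt (a :: k) = a + wt k := by simp [wt]

theorem length_word (k : Index) : (word k).length = wt k := by
  induction k with
  | nil => simp [word, wt]
  | cons a k ih =>
    have := a.pos
    rw [word_cons, List.length_cons, List.length_append, List.length_replicate, ih,
      wt_cons]
    omega

/-- A reversed index has the word obtained by reversing all but the leading `y`. -/
theorem word_reverse_of_word_eq {k : Index} {b : List Letter} (h : word k = Letter.y :: b) :
    word k.reverse = Letter.y :: b.reverse := by
  have key : ∀ k : Index, word k.reverse ++ [Letter.y] = Letter.y :: (word k).reverse := by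
    intro k
    induction k with
    | nil => simp [word]
    | cons a k ih =>
      rw [List.reverse_cons, word_append, word_cons, word_cons]
      have h1 : word [] = [] := by simp [word]
      have ih' := congrArg (· ++ (List.replicate ((a : ℕ) - 1) Letter.x ++ [Letter.y])) ih
      simp only [List.append_assoc, List.cons_append, List.nil_append] at ih'
      simp [h1, ih']
  have h1 := key k
  rw [h, List.reverse_cons, ← List.cons_append] at h1
  exact List.append_cancel_right h1

theorem exists_word_of_good {u : List Letter} (hu : Good u) : ∃ k, word k = u := by
  have hg : GoodRev u.reverse := by
    rcases hu with rfl | ⟨v, rfl⟩ <;> simp [GoodRev]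
  have h := word_decodeRev u.reverse hg 1 (fun _ => rfl)
  refine ⟨(decodeRev 1 u.reverse).reverse, ?_⟩
  rw [← List.reverse_inj, h]
  simp

theorem good_word (k : Index) : Good (word k) := by
  rcases k with _ | ⟨a, k⟩
  · exact Or.inl (by simp [word])
  · exact Or.inr ⟨_, word_cons a k⟩

theorem sh_x_xPow_cat (m : ℕ) (k : Index) :
    sh (xPow 1) (cat (xPow m) (bw (word k)))
      = ((m : ℚ) + 1) • cat (xPow (m + 1)) (bw (word k))
        + cat (xPow m) (pre Letter.y (sh (xPow 1) (leftY (bw (word k))))) := by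
  rcases good_word k with h | ⟨b, h⟩
  · rw [h, leftY_nil]
    have h' : ∀ m, cat (xPow m) (bw []) = xPow m := fun m => by simp [xPow]
    rw [h', h', sh_x_xPow]
    simp
  · rw [h, ← pre_bw, sh_x_cat, sh_x_xPow, leftY_pre_y, map_smul, LinearMap.smul_apply]

/-- On words, the derivation `deriv` shuffles `x` into the part after the leading `y`. -/
theorem toWords_deriv (v : H1) :
    toWords (deriv v) = pre Letter.y (sh (xPow 1) (leftY (toWords v))) := by
  refine hom_ext_apply (toWords ∘ₗ deriv) (pre Letter.y ∘ₗ sh (xPow 1) ∘ₗ leftY ∘ₗ toWords)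
    (fun k => ?_) v
  simp only [LinearMap.comp_apply]
  have hpre : ∀ (a : ℕ+) (v : H1), toWords (pre a v)
      = pre Letter.y (cat (xPow ((a : ℕ) - 1)) (toWords v)) := fun a v =>
    hom_ext_apply (toWords ∘ₗ pre a) (pre Letter.y ∘ₗ cat (xPow ((a : ℕ) - 1)) ∘ₗ toWords)
      (fun k => by simp [word_cons, xPow]) v
  induction k with
  | nil => simp [deriv_nil, word, leftY_nil]
  | cons a k ih =>
    obtain ⟨m, hm⟩ : ∃ m, (a : ℕ) = m + 1 := ⟨a - 1, by have := a.pos; omega⟩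
    rw [← pre_bw, deriv_pre, map_add, map_smul, hpre, hpre, hpre, ih, leftY_pre_y, toWords_bw,
      sh_x_xPow_cat, map_add, map_smul, PNat.add_coe, hm]
    simp

theorem toWords_dividedPow_deriv (n : ℕ) {k : Index} {b : List Letter}
    (h : word k = Letter.y :: b) :
    toWords (dividedPow deriv n (bw k)) = pre Letter.y (sh (xPow n) (bw b)) := by
  rw [dividedPow_comm toWords deriv (pre Letter.y ∘ₗ sh (xPow 1) ∘ₗ leftY)
    (fun u => by simpa using toWords_deriv u), toWords_bw, h, ← pre_bw, ← dividedPow_sh]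
  exact (dividedPow_comm (pre Letter.y) (sh (xPow 1)) (pre Letter.y ∘ₗ sh (xPow 1) ∘ₗ leftY)
    (fun u => by simp only [LinearMap.comp_apply, leftY_pre_y]) n (bw b)).symm

theorem rev_dividedPow_deriv (n : ℕ) (v : H1) :
    rev (dividedPow deriv n v) = dividedPow deriv n (rev v) :=
  dividedPow_comm rev deriv deriv rev_deriv n v

/-- The shuffle regularization, as a functional on words. -/
noncomputable def wordHom : Words →ₗ[ℚ] MZVAlg :=
  Finsupp.linearCombination ℚ fun w => zetaSh (decode w)

theorem wordHom_toWords (v : H1) : wordHom (toWords v) = shHom v :=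
  hom_ext_apply (wordHom ∘ₗ toWords) shHom
    (fun k => by simp [wordHom, decode_word, shHom_bw]) v

theorem wordHom_nil : wordHom (bw []) = 1 := by
  have h : toWords (bw []) = bw [] := by simp [word]
  rw [← h, wordHom_toWords]
  exact regHom_nil _

theorem wordHom_sh (u v : List Letter) (hu : Good u) (hv : Good v) :
    wordHom (sh (bw u) (bw v)) = wordHom (bw u) * wordHom (bw v) := by
  obtain ⟨k, rfl⟩ := exists_word_of_good hu
  obtain ⟨l, rfl⟩ := exists_word_of_good hv
  rw [← toWords_bw, ← toWords_bw, ← toWords_mulH1, wordHom_toWords, wordHom_toWords,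
    wordHom_toWords, shHom_mul]

theorem cutHom_word (n : ℕ) (k : Index) :
    cutHom wordHom n (bw (word k)) = dualCoeff shHom n (bw k) := by
  rcases k with _ | ⟨a, k⟩
  · have h : word [] = [] := by simp [word]
    simp only [h, cutHom_apply, counit_nil, leftY_nil, map_zero, sub_zero, one_smul, dualCoeff,
      LinearMap.comp_apply, signHom_bw, map_smul, dividedPow_deriv_nil]
    have h1 : shHom (bw []) = 1 := regHom_nil _
    split_ifs <;> simp [wt, h1]
  · obtain ⟨b, hb⟩ : ∃ b, word (a :: k) = Letter.y :: b := ⟨_, word_cons a k⟩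
    have hlen : wt (a :: k) = b.length + 1 := by rw [← length_word, hb, List.length_cons]
    simp only [dualCoeff, LinearMap.comp_apply, signHom_bw, map_smul, rev_dividedPow_deriv, rev_bw]
    rw [← wordHom_toWords, toWords_dividedPow_deriv n (word_reverse_of_word_eq hb), hb, hlen,
      ← pre_bw, cutHom_apply, counit_pre, leftY_pre_y, hookHom_apply, antipode_bw]
    simp only [map_smul, pow_succ]
    split_ifs <;> simp

theorem tmulHom_comp_pre {A : Type*} [CommRing A] [Algebra ℚ A] (f g : Words →ₗ[ℚ] A)
    (a : Letter) : tmulHom f g ∘ₗ pre a = tmulHom (f ∘ₗ pre a) g :=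
  LinearMap.ext fun P => LinearMap.ext fun Q => by
    simp only [LinearMap.comp_apply, tmulHom_apply]

/-- Only the cuts in front of a letter `y` contribute. -/
theorem deconc_cutHom_word {A : Type*} [CommRing A] [Algebra ℚ A] (L f : Words →ₗ[ℚ] A) (n : ℕ)
    (k : Index) :
    deconc (tmulHom f (cutHom L n)) (bw (word k)) = ∑ i ∈ Finset.range (k.length + 1),
      f (bw (word (k.take i))) * cutHom L n (bw (word (k.drop i))) := by
  have skip : ∀ (m : ℕ) (f : Words →ₗ[ℚ] A) (P : Words),
      deconc (tmulHom f (cutHom L n)) (cat (xPow m) P)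
        = deconc (tmulHom (f ∘ₗ cat (xPow m)) (cutHom L n)) P := by
    intro m
    induction m with
    | zero =>
      intro f P
      have e : f ∘ₗ cat (xPow 0) = f :=
        LinearMap.ext fun P => by simp only [LinearMap.comp_apply, xPow_zero, cat_nil_left]
      rw [e, xPow_zero, cat_nil_left]
    | succ m ih =>
      intro f P
      have e : (f ∘ₗ pre Letter.x) ∘ₗ cat (xPow m) = f ∘ₗ cat (xPow (m + 1)) :=
        LinearMap.ext fun P => by simp only [LinearMap.comp_apply, xPow_succ, cat_pre]
      rw [xPow_succ, cat_pre, deconc_pre, tmulHom_comp_pre, ih, e, tmulHom_apply, cutHom_apply,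
        counit_pre, leftY_pre_x]
      simp [xPow_succ]
  induction k generalizing f with
  | nil => simp [word, deconc_bw]
  | cons a k ih =>
    have e : ∀ j : Index, bw (word (a :: j))
        = pre Letter.y (cat (xPow ((a : ℕ) - 1)) (bw (word j))) := fun j => by
      simp [word_cons, xPow]
    have h0 : word [] = [] := by simp [word]
    rw [e, deconc_pre, tmulHom_comp_pre, skip, ih, List.length_cons,
      Finset.sum_range_succ' _ (k.length + 1), add_comm]
    simp only [List.take_succ_cons, List.drop_succ_cons, List.take_zero, List.drop_zero, e, h0,
      LinearMap.comp_apply, tmulHom_apply]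

theorem coeff_symmHom (n : ℕ) (k : Index) :
    PowerSeries.coeff n (symmHom shHom (bw k)) = wordSymm wordHom n (bw (word k)) := by
  rw [wordSymm, deconc_cutHom_word, symmHom, deconc_bw, map_sum]
  refine Finset.sum_congr rfl fun i _ => ?_
  rw [tmulHom_apply, constHom_apply, PowerSeries.coeff_C_mul, coeff_dualHom, cutHom_word,
    ← toWords_bw, wordHom_toWords]

/-- The shuffle relations. -/
theorem symmZetaSh_shuffleProd (k l : Index) :
    ((shuffleProd k l).map symmZetaSh).sum = (-1) ^ wt l * tupleSum l.length (fun l' =>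
      (bcoeff l l' : PowerSeries MZVAlg) * symmZetaSh (k ++ (shift l l').reverse)) := by
  ext1 n
  have hsign : ((-1) ^ wt l : PowerSeries MZVAlg) = PowerSeries.C ((-1) ^ wt l) := by simp
  have hleft : PowerSeries.coeff n ((shuffleProd k l).map symmZetaSh).sum
      = wordSymm wordHom n (sh (bw (word k)) (bw (word l))) := by
    rw [← sum_wordShuffle, ← map_word_shuffle, map_multiset_sum, map_multiset_sum,
      Multiset.map_map, Multiset.map_map, Multiset.map_map]
    refine congrArg _ (Multiset.map_congr rfl fun h _ => ?_)
    rw [Function.comp_apply, ← symmHom_shHom, coeff_symmHom]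
    rfl
  -- `b(l; l')`-weighted sums of shifted indices are divided powers of the derivation
  have hright : PowerSeries.coeff n (tupleSum l.length (fun l' =>
        (bcoeff l l' : PowerSeries MZVAlg) * symmZetaSh (k ++ (shift l l').reverse)))
      = ∑ p ∈ antidiagonal n, wordSymm wordHom p.2
          (cat (bw (word k)) (toWords (rev (dividedPow deriv p.1 (bw l))))) := by
    rw [coeff_tupleSum]
    refine Finset.sum_congr rfl fun p _ => ?_
    rw [← sum_bcoeff_shift]
    simp only [map_sum, map_smul, rev_bw, toWords_bw, cat_bw]
    refine Finset.sum_congr rfl fun l' _ => ?_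
    rw [← word_append, ← coeff_symmHom, symmHom_shHom, ← nsmul_eq_mul, map_nsmul,
      Nat.cast_smul_eq_nsmul]
  rw [hleft, hsign, PowerSeries.coeff_C_mul, hright]
  rcases l with _ | ⟨a, l⟩
  · have h : word [] = [] := by simp [word]
    simp only [dividedPow_deriv_nil, h, qsh_nil_right]
    rw [Finset.sum_eq_single (0, n)]
    · simp [wt, h]
    · rintro ⟨i, j⟩ hp hne
      rw [mem_antidiagonal] at hp
      have hi : i ≠ 0 := by rintro rfl; exact hne (by simp at hp; rw [hp])
      simp [hi]
    · intro h
      exact absurd (mem_antidiagonal.2 (zero_add n)) h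
  · obtain ⟨b, hb⟩ : ∃ b, word (a :: l) = Letter.y :: b := ⟨_, word_cons a l⟩
    have hlen : wt (a :: l) = b.length + 1 := by rw [← length_word, hb, List.length_cons]
    rw [hb, wordSymm_shuffle wordHom_sh wordHom_nil n (good_word k), hlen]
    simp only [rev_dividedPow_deriv, rev_bw,
      toWords_dividedPow_deriv _ (word_reverse_of_word_eq hb), antipode_bw, map_smul]
    rw [← Finset.smul_sum, Algebra.smul_def]
    simp [pow_succ]

end TadicMZV

theorem theorem1p1 (k l : TadicMZV.Index) :
    ((TadicMZV.harmonicProd k l).map TadicMZV.symmZetaStar).sum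
        = TadicMZV.symmZetaStar k * TadicMZV.symmZetaStar l ∧
    ((TadicMZV.shuffleProd k l).map TadicMZV.symmZetaSh).sum
        = (-1) ^ TadicMZV.wt l * TadicMZV.tupleSum l.length (fun l' =>
            (TadicMZV.bcoeff l l' : PowerSeries TadicMZV.MZVAlg) *
              TadicMZV.symmZetaSh (k ++ (TadicMZV.shift l l').reverse)) :=
  ⟨TadicMZV.symmZetaStar_harmonicProd k l, TadicMZV.symmZetaSh_shuffleProd k l⟩
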